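/- Let $E$ be an infinite-dimensional real separable Hilbert space with an orthonormal basis $\mathcal E=\{e_j\}_{j\in\mathbb N}$. **The space.** A block is a set $\Pi_{a,b}=\{x\in E: (e_j,x)\in[a_j,b_j)\ \forall j\}$ with $a,b\in\ell_\infty$, $a_j<b_j$; it is absolutely measurable if it is empty or $\sum_j\max\{0,\ln(b_j-a_j)\}<\infty$. Let $\lambda_{\mathcal E}$ be the finitely additive measure on the minimal ring containing all absolutely measurable blocks with $\lambda_{\mathcal E}(\Pi_{a,b})=\prod_j(b_j-a_j)$ for every non-empty absolutely measurable block (it exists, is unique and is shift-invariant), extended to the completed ring $\mathcal R_{\mathcal E}$ of all sets $A$ such that for every $\varepsilon>0$ there are sets $B\subseteq A\subseteq C$ in the ring with $\lambda_{\mathcal E}(C\setminus B)<\varepsilon$. Let $\mathcal H_{\mathcal E}$ be the complex Hilbert space obtained by completing the linear combinations of indicators of sets of $\mathcal R_{\mathcal E}$ with respect to the seminorm $\big\|\sum_k c_k\chi_{B_k}\big\|^2=\sum_k|c_k|^2\lambda_{\mathcal E}(B_k)$ ($B_k$ pairwise disjoint), after factoring out the functions of zero seminorm. **The operators.** For $h\in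 E$ let $S_hf(x)=f(x-h)$ on $\mathcal H_{\mathcal E}$. Let $P_n$ be the orthogonal projection onto $\mathrm{span}(e_1,\dots,e_n)$. For $h\in E$ with $\sum_k|(h,e_k)|<\infty$ let $\widehat S_h$ be the strong limit, as $n\to\infty$, of the operators of multiplication by $e^{i(P_nh,x)}$ on $\mathcal H_{\mathcal E}$. For a non-negative nuclear operator $D$ on $E$ for which every $e_k$ is an eigenvector, let $\nu_D$ be the centered Gaussian Borel measure on $E$ with Fourier transform $\xi\mapsto e^{-\frac12(D\xi,\xi)}$, and define on $\mathcal H_{\mathcal E}$ $$\mathcal U_D=\int_E S_h\,d\nu_D(h),\qquad \widehat{\mathcal U}_D=\operatorname*{s-lim}_{n\to\infty}\widehat{\mathcal U}_{DP_n},\qquad \widehat{\mathcal U}_{DP_n}=\int_E\widehat S_h\,d\nu_{DP_n}(h),$$ where the operator integrals are Pettis integrals, i.e. $(\mathcal U_Df,g)=\int_E(S_hf,g)\,d\nu_D(h)$ for all $f,g\in\mathcal H_{\mathcal E}$, and similarly for $\widehat{\mathcal U}_{DP_n}$. **Theorem.** There is no unitary operator $\mathcal F$ of $\mathcal H_{\mathcal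 E}$ onto itself such that, for every non-negative nuclear operator $D$ on $E$ with basis of eigenvectors $\mathcal E$, $$\mathcal U_{tD}=\mathcal F\,\widehat{\mathcal U}_{tD}\,\mathcal F^{-1}\qquad\text{for all } t\ge 0 .$$ -/

import Mathlib

noncomputable section

open MeasureTheory Filter Topology Set

/-- A finitely additive non-negative finite-valued measure on a ring of subsets of `X`
(the values of `m` outside `sets` are irrelevant). -/
structure FinAddMeasure (X : Type*) where
  sets : Set (Set X)
  isSetRing : IsSetRing sets
  m : Set X → ℝ
  nonneg : ∀ A ∈ sets, 0 ≤ m A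
  add : ∀ A ∈ sets, ∀ B ∈ sets, Disjoint A B → m (A ∪ B) = m A + m B

namespace FinAddMeasure

variable {X : Type*} (μ : FinAddMeasure X)

theorem m_empty : μ.m ∅ = 0 := by
  have h := μ.add ∅ μ.isSetRing.empty_mem ∅ μ.isSetRing.empty_mem (by simp)
  simp at h
  exact h

theorem m_diff {A B : Set X} (hA : A ∈ μ.sets) (hB : B ∈ μ.sets) (h : A ⊆ B) :
    μ.m B = μ.m A + μ.m (B \ A) := by
  rw [← μ.add A hA _ (μ.isSetRing.sdiff_mem hB hA) disjoint_sdiff_right,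
    Set.union_sdiff_cancel h]

theorem m_mono {A B : Set X} (hA : A ∈ μ.sets) (hB : B ∈ μ.sets) (h : A ⊆ B) :
    μ.m A ≤ μ.m B := by
  have h1 := μ.m_diff hA hB h
  have h2 := μ.nonneg _ (μ.isSetRing.sdiff_mem hB hA)
  linarith

theorem m_union_le {A B : Set X} (hA : A ∈ μ.sets) (hB : B ∈ μ.sets) :
    μ.m (A ∪ B) ≤ μ.m A + μ.m B := by
  have hD := μ.isSetRing.sdiff_mem hB hA
  have h1 := μ.add A hA _ hD disjoint_sdiff_right
  rw [Set.union_sdiff_self] at h1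
  have h2 := μ.m_mono hD hB sdiff_subset
  linarith

theorem m_biUnion {ι : Type*} (T : Finset ι) (B : ι → Set X) (hB : ∀ i ∈ T, B i ∈ μ.sets)
    (hd : ∀ i ∈ T, ∀ j ∈ T, i ≠ j → Disjoint (B i) (B j)) :
    (⋃ i ∈ T, B i) ∈ μ.sets ∧ μ.m (⋃ i ∈ T, B i) = ∑ i ∈ T, μ.m (B i) := by
  classical
  induction T using Finset.induction_on with
  | empty => simpa using ⟨μ.isSetRing.empty_mem, μ.m_empty⟩
  | insert a T ha ih =>
    obtain ⟨h1, h2⟩ := ih (fun i hi => hB i (Finset.mem_insert_of_mem hi))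
      (fun i hi j hj => hd i (Finset.mem_insert_of_mem hi) j (Finset.mem_insert_of_mem hj))
    have ha' := hB a (Finset.mem_insert_self a T)
    rw [Finset.set_biUnion_insert, Finset.sum_insert ha]
    refine ⟨μ.isSetRing.union_mem ha' h1, ?_⟩
    rw [μ.add _ ha' _ h1, h2]
    rw [Set.disjoint_iUnion₂_right]
    intro i hi
    exact hd a (Finset.mem_insert_self a T) i (Finset.mem_insert_of_mem hi)
      (fun h => ha (h ▸ hi))

/-! ### Completion of a finitely additive measure -/

/-- The sets which can be squeezed between members of the ring of arbitrarily close measure. -/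
def complSets : Set (Set X) :=
  {A | ∀ ε > 0, ∃ B ∈ μ.sets, ∃ C ∈ μ.sets, B ⊆ A ∧ A ⊆ C ∧ μ.m (C \ B) < ε}

/-- The measure of a set of the completed ring. -/
def complM (A : Set X) : ℝ := sInf (μ.m '' {C | C ∈ μ.sets ∧ A ⊆ C})

theorem complM_le {A C : Set X} (hC : C ∈ μ.sets) (h : A ⊆ C) : μ.complM A ≤ μ.m C :=
  csInf_le ⟨0, by rintro _ ⟨D, hD, rfl⟩; exact μ.nonneg D hD.1⟩ ⟨C, ⟨hC, h⟩, rfl⟩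

theorem le_complM {A B C : Set X} (hB : B ∈ μ.sets) (hC : C ∈ μ.sets) (h : B ⊆ A) (h' : A ⊆ C) :
    μ.m B ≤ μ.complM A :=
  le_csInf ⟨_, C, ⟨hC, h'⟩, rfl⟩
    (by rintro _ ⟨D, hD, rfl⟩; exact μ.m_mono hB hD.1 (h.trans hD.2))

theorem complM_eq {A : Set X} (hA : A ∈ μ.sets) : μ.complM A = μ.m A :=
  le_antisymm (μ.complM_le hA subset_rfl) (μ.le_complM hA hA subset_rfl subset_rfl)

theorem subset_complSets : μ.sets ⊆ μ.complSets := fun A hA ε hε =>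
  ⟨A, hA, A, hA, subset_rfl, subset_rfl, by simpa [μ.m_empty] using hε⟩

theorem isSetRing_complSets : IsSetRing μ.complSets where
  empty_mem := μ.subset_complSets μ.isSetRing.empty_mem
  union_mem := by
    intro A₁ A₂ h₁ h₂ ε hε
    obtain ⟨B₁, hB₁, C₁, hC₁, b₁, c₁, e₁⟩ := h₁ (ε / 2) (half_pos hε)
    obtain ⟨B₂, hB₂, C₂, hC₂, b₂, c₂, e₂⟩ := h₂ (ε / 2) (half_pos hε)
    have R := μ.isSetRing
    refine ⟨_, R.union_mem hB₁ hB₂, _, R.union_mem hC₁ hC₂, union_subset_union b₁ b₂,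
      union_subset_union c₁ c₂, ?_⟩
    have h1 := μ.m_union_le (R.sdiff_mem hC₁ hB₁) (R.sdiff_mem hC₂ hB₂)
    have h2 : μ.m ((C₁ ∪ C₂) \ (B₁ ∪ B₂)) ≤ μ.m (C₁ \ B₁ ∪ C₂ \ B₂) := by
      refine μ.m_mono (R.sdiff_mem (R.union_mem hC₁ hC₂) (R.union_mem hB₁ hB₂))
        (R.union_mem (R.sdiff_mem hC₁ hB₁) (R.sdiff_mem hC₂ hB₂)) ?_
      intro x; simp only [Set.mem_sdiff, mem_union]; tauto
    linarith
  sdiff_mem := by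
    intro A₁ A₂ h₁ h₂ ε hε
    obtain ⟨B₁, hB₁, C₁, hC₁, b₁, c₁, e₁⟩ := h₁ (ε / 2) (half_pos hε)
    obtain ⟨B₂, hB₂, C₂, hC₂, b₂, c₂, e₂⟩ := h₂ (ε / 2) (half_pos hε)
    have R := μ.isSetRing
    refine ⟨_, R.sdiff_mem hB₁ hC₂, _, R.sdiff_mem hC₁ hB₂, sdiff_subset_sdiff b₁ c₂,
      sdiff_subset_sdiff c₁ b₂, ?_⟩
    have h1 := μ.m_union_le (R.sdiff_mem hC₁ hB₁) (R.sdiff_mem hC₂ hB₂)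
    have h2 : μ.m ((C₁ \ B₂) \ (B₁ \ C₂)) ≤ μ.m (C₁ \ B₁ ∪ C₂ \ B₂) := by
      refine μ.m_mono (R.sdiff_mem (R.sdiff_mem hC₁ hB₂) (R.sdiff_mem hB₁ hC₂))
        (R.union_mem (R.sdiff_mem hC₁ hB₁) (R.sdiff_mem hC₂ hB₂)) ?_
      intro x; simp only [Set.mem_sdiff, mem_union]; tauto
    linarith

/-- The (Peano–Jordan type) completion of a finitely additive measure. -/
def completion : FinAddMeasure X where
  sets := μ.complSets
  isSetRing := μ.isSetRing_complSets
  m := μ.complM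
  nonneg := by
    intro A hA
    obtain ⟨B, hB, C, hC, b, c, -⟩ := hA 1 one_pos
    exact (μ.nonneg B hB).trans (μ.le_complM hB hC b c)
  add := by
    intro A₁ h₁ A₂ h₂ hd
    have key : ∀ ε > 0, |μ.complM (A₁ ∪ A₂) - (μ.complM A₁ + μ.complM A₂)| ≤ ε := by
      intro ε hε
      obtain ⟨B₁, hB₁, C₁, hC₁, b₁, c₁, e₁⟩ := h₁ (ε / 2) (half_pos hε)
      obtain ⟨B₂, hB₂, C₂, hC₂, b₂, c₂, e₂⟩ := h₂ (ε / 2) (half_pos hε)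
      have R := μ.isSetRing
      have i1 := μ.add B₁ hB₁ B₂ hB₂ (hd.mono b₁ b₂)
      have i2 := μ.le_complM (R.union_mem hB₁ hB₂) (R.union_mem hC₁ hC₂)
        (union_subset_union b₁ b₂) (union_subset_union c₁ c₂)
      have i3 := μ.complM_le (R.union_mem hC₁ hC₂) (union_subset_union c₁ c₂)
      have i4 := μ.m_union_le hC₁ hC₂
      have i5 := μ.m_diff hB₁ hC₁ (b₁.trans c₁)
      have i6 := μ.m_diff hB₂ hC₂ (b₂.trans c₂)
      have i7 := μ.le_complM hB₁ hC₁ b₁ c₁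
      have i8 := μ.le_complM hB₂ hC₂ b₂ c₂
      have i9 := μ.complM_le hC₁ c₁
      have i10 := μ.complM_le hC₂ c₂
      rw [abs_le]
      constructor <;> linarith
    have h0 := le_of_forall_pos_le_add (b := (0 : ℝ)) (fun ε hε => by
      rw [zero_add]
      exact key ε hε)
    exact sub_eq_zero.1 (abs_nonpos_iff.1 h0)

/-- `τ` maps the ring into itself by preimages and preserves the measure. -/
structure Preserves (τ : X → X) : Prop where
  mem : ∀ A ∈ μ.sets, τ ⁻¹' A ∈ μ.sets
  m_eq : ∀ A ∈ μ.sets, μ.m (τ ⁻¹' A) = μ.m A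

variable {μ} in
theorem Preserves.mem_completion {τ : X → X} (h : μ.Preserves τ) {A : Set X}
    (hA : A ∈ μ.complSets) : τ ⁻¹' A ∈ μ.complSets := by
  intro ε hε
  obtain ⟨B, hB, C, hC, b, c, e⟩ := hA ε hε
  refine ⟨_, h.mem B hB, _, h.mem C hC, preimage_mono b, preimage_mono c, ?_⟩
  rw [← preimage_sdiff, h.m_eq _ (μ.isSetRing.sdiff_mem hC hB)]
  exact e

variable {μ} in
theorem Preserves.completion_le {τ : X → X} (h : μ.Preserves τ) {A : Set X}
    (hA : A ∈ μ.complSets) : μ.complM (τ ⁻¹' A) ≤ μ.complM A := by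
  obtain ⟨B, hB, C, hC, b, c, -⟩ := hA 1 one_pos
  refine le_csInf ⟨_, C, ⟨hC, c⟩, rfl⟩ ?_
  rintro _ ⟨D, hD, rfl⟩
  rw [← h.m_eq D hD.1]
  exact μ.complM_le (h.mem D hD.1) (preimage_mono hD.2)

variable {μ} in
theorem Preserves.completion {τ σ : X → X} (h : μ.Preserves τ) (h' : μ.Preserves σ)
    (hστ : ∀ x, τ (σ x) = x) : μ.completion.Preserves τ where
  mem _ hA := h.mem_completion hA
  m_eq A hA := by
    refine le_antisymm (h.completion_le hA) ?_
    have h1 := h'.completion_le (h.mem_completion hA)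
    have h2 : σ ⁻¹' (τ ⁻¹' A) = A := by
      ext x; simp [hστ]
    rw [h2] at h1
    exact h1

/-! ### The Hilbert space of square integrable functions -/

/-- `f` is a simple function, i.e. a linear combination of indicators of sets of the ring:
it takes finitely many values, and every level set of a non-zero value lies in the ring. -/
def IsSimple (f : X → ℂ) : Prop :=
  (range f).Finite ∧ ∀ z ≠ 0, f ⁻¹' {z} ∈ μ.sets

/-- The integral `∑ z, z * μ {f = z}` of a simple function. -/
def integral (f : X → ℂ) : ℂ := ∑ᶠ z : ℂ, (μ.m (f ⁻¹' {z}) : ℂ) * z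

theorem preimage_comp_eq {Y : Type*} {p : X → Y} {T : Finset Y} (hT : ∀ x, p x ∈ T)
    (φ : Y → ℂ) (z : ℂ) [DecidableEq ℂ] :
    (fun x => φ (p x)) ⁻¹' {z} = ⋃ y ∈ T.filter (fun y => φ y = z), p ⁻¹' {y} := by
  ext x
  simp only [mem_preimage, mem_singleton_iff, Finset.mem_filter, mem_iUnion, exists_prop]
  constructor
  · intro h
    exact ⟨p x, ⟨hT x, h⟩, rfl⟩
  · rintro ⟨y, ⟨-, h⟩, rfl⟩
    exact h

theorem isSimple_comp {Y : Type*} {p : X → Y} {T : Finset Y} (hT : ∀ x, p x ∈ T) (y₀ : Y)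
    (hp : ∀ y ≠ y₀, p ⁻¹' {y} ∈ μ.sets) (φ : Y → ℂ) (hφ : φ y₀ = 0) :
    μ.IsSimple (fun x => φ (p x)) := by
  classical
  refine ⟨(T.image φ).finite_toSet.subset ?_, ?_⟩
  · rintro _ ⟨x, rfl⟩
    exact Finset.mem_coe.2 (Finset.mem_image_of_mem φ (hT x))
  · intro z hz
    rw [preimage_comp_eq hT]
    refine (μ.m_biUnion _ _ ?_ ?_).1
    · intro y hy
      refine hp y ?_
      rintro rfl
      exact hz ((Finset.mem_filter.1 hy).2.symm.trans hφ)
    · intro i _ j _ hij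
      exact Disjoint.preimage _ (by simpa using hij)

theorem integral_comp {Y : Type*} {p : X → Y} {T : Finset Y} (hT : ∀ x, p x ∈ T) (y₀ : Y)
    (hp : ∀ y ≠ y₀, p ⁻¹' {y} ∈ μ.sets) (φ : Y → ℂ) (hφ : φ y₀ = 0) :
    μ.integral (fun x => φ (p x)) = ∑ y ∈ T, (μ.m (p ⁻¹' {y}) : ℂ) * φ y := by
  classical
  have hz : ∀ z : ℂ, (μ.m ((fun x => φ (p x)) ⁻¹' {z}) : ℂ) * z =
      ∑ y ∈ T.filter (fun y => φ y = z), (μ.m (p ⁻¹' {y}) : ℂ) * φ y := by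
    intro z
    by_cases h0 : z = 0
    · rw [h0, mul_zero, Finset.sum_eq_zero]
      intro y hy
      rw [(Finset.mem_filter.1 hy).2, mul_zero]
    · rw [preimage_comp_eq hT, (μ.m_biUnion _ _ _ _).2]
      · rw [Complex.ofReal_sum, Finset.sum_mul]
        refine Finset.sum_congr rfl fun y hy => ?_
        rw [(Finset.mem_filter.1 hy).2]
      · intro y hy
        refine hp y ?_
        rintro rfl
        exact h0 ((Finset.mem_filter.1 hy).2.symm.trans hφ)
      · intro i _ j _ hij
        exact Disjoint.preimage _ (by simpa using hij)
  unfold integral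
  rw [finsum_eq_sum_of_support_subset (s := T.image φ)]
  · simp_rw [hz]
    exact Finset.sum_fiberwise_of_maps_to (fun y hy => Finset.mem_image_of_mem φ hy) _
  · intro z hz'
    rw [Function.mem_support, hz z] at hz'
    obtain ⟨y, hy, -⟩ := Finset.exists_ne_zero_of_sum_ne_zero hz'
    rw [Finset.mem_coe, ← (Finset.mem_filter.1 hy).2]
    exact Finset.mem_image_of_mem φ (Finset.mem_filter.1 hy).1

theorem IsSimple.pair {f g : X → ℂ} (hf : μ.IsSimple f) (hg : μ.IsSimple g) :
    ∃ T : Finset (ℂ × ℂ), (∀ x, (f x, g x) ∈ T) ∧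
      ∀ y ≠ ((0, 0) : ℂ × ℂ), (fun x => (f x, g x)) ⁻¹' {y} ∈ μ.sets := by
  classical
  refine ⟨hf.1.toFinset ×ˢ hg.1.toFinset, fun x => by simp, ?_⟩
  have R := μ.isSetRing
  rintro ⟨a, b⟩ hab
  have hpre : (fun x => (f x, g x)) ⁻¹' {(a, b)} = f ⁻¹' {a} ∩ g ⁻¹' {b} := by
    ext x; simp
  rw [hpre]
  have hU : ∀ {u : X → ℂ}, μ.IsSimple u → {x | u x ≠ 0} ∈ μ.sets := by
    intro u hu
    have : {x | u x ≠ 0} = ⋃ z ∈ hu.1.toFinset.filter (fun z => z ≠ 0), u ⁻¹' {z} := by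
      ext x; simp
    rw [this]
    refine (μ.m_biUnion _ _ (fun z hz => hu.2 z (Finset.mem_filter.1 hz).2) ?_).1
    intro i _ j _ hij
    exact Disjoint.preimage _ (by simpa using hij)
  by_cases ha : a = 0
  · have hb : b ≠ 0 := by
      rintro rfl
      exact hab (by rw [ha])
    have : f ⁻¹' {a} ∩ g ⁻¹' {b} = g ⁻¹' {b} \ {x | f x ≠ 0} := by
      ext x; simp [ha, and_comm]
    rw [this]
    exact R.sdiff_mem (hg.2 b hb) (hU hf)
  · by_cases hb : b = 0
    · have : f ⁻¹' {a} ∩ g ⁻¹' {b} = f ⁻¹' {a} \ {x | g x ≠ 0} := by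
        ext x; simp [hb]
      rw [this]
      exact R.sdiff_mem (hf.2 a ha) (hU hg)
    · exact R.inter_mem (hf.2 a ha) (hg.2 b hb)

theorem IsSimple.map₂ {f g : X → ℂ} (hf : μ.IsSimple f) (hg : μ.IsSimple g)
    (φ : ℂ × ℂ → ℂ) (hφ : φ (0, 0) = 0) : μ.IsSimple (fun x => φ (f x, g x)) := by
  obtain ⟨T, hT, hp⟩ := IsSimple.pair μ hf hg
  exact μ.isSimple_comp hT (0, 0) hp φ hφ

theorem IsSimple.integral_map₂_add {f g : X → ℂ} (hf : μ.IsSimple f) (hg : μ.IsSimple g)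
    (φ ψ : ℂ × ℂ → ℂ) (hφ : φ (0, 0) = 0) (hψ : ψ (0, 0) = 0) :
    μ.integral (fun x => φ (f x, g x) + ψ (f x, g x)) =
      μ.integral (fun x => φ (f x, g x)) + μ.integral (fun x => ψ (f x, g x)) := by
  obtain ⟨T, hT, hp⟩ := IsSimple.pair μ hf hg
  rw [μ.integral_comp hT (0, 0) hp φ hφ, μ.integral_comp hT (0, 0) hp ψ hψ,
    μ.integral_comp hT (0, 0) hp (fun y => φ y + ψ y) (by simp [hφ, hψ]), ← Finset.sum_add_distrib]
  exact Finset.sum_congr rfl fun y _ => by ring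

theorem IsSimple.integral_add {f g : X → ℂ} (hf : μ.IsSimple f) (hg : μ.IsSimple g) :
    μ.integral (fun x => f x + g x) = μ.integral f + μ.integral g :=
  IsSimple.integral_map₂_add μ hf hg Prod.fst Prod.snd rfl rfl

theorem IsSimple.integral_map {f : X → ℂ} (hf : μ.IsSimple f) (φ : ℂ → ℂ) (hφ : φ 0 = 0) :
    μ.integral (fun x => φ (f x)) = ∑ z ∈ hf.1.toFinset, (μ.m (f ⁻¹' {z}) : ℂ) * φ z :=
  μ.integral_comp (fun x => by simp) 0 hf.2 φ hφ

/-- The space of simple functions over the ring. -/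
def simpleSubmodule : Submodule ℂ (X → ℂ) where
  carrier := {f | μ.IsSimple f}
  zero_mem' := by
    refine ⟨(Set.finite_singleton (0 : ℂ)).subset (by rintro _ ⟨x, rfl⟩; simp), ?_⟩
    intro z hz
    have : (0 : X → ℂ) ⁻¹' {z} = ∅ := by
      ext x; simpa using hz.symm
    rw [this]
    exact μ.isSetRing.empty_mem
  add_mem' := fun {f g} hf hg => IsSimple.map₂ μ hf hg (fun y => y.1 + y.2) (by simp)
  smul_mem' := fun c f hf => IsSimple.map₂ μ hf hf (fun y => c * y.1) (by simp)

/-- The space of simple functions, to be endowed with the seminorm `p₂`. -/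
def Simple : Type _ := μ.simpleSubmodule

instance : AddCommGroup μ.Simple := inferInstanceAs (AddCommGroup μ.simpleSubmodule)

instance : Module ℂ μ.Simple := inferInstanceAs (Module ℂ μ.simpleSubmodule)

variable {μ}

/-- The function underlying a simple function. -/
def Simple.toFun (f : μ.Simple) : X → ℂ := Subtype.val f

theorem Simple.isSimple (f : μ.Simple) : μ.IsSimple f.toFun := Subtype.property f

@[simp] theorem Simple.toFun_add (f g : μ.Simple) (x : X) :
    (f + g).toFun x = f.toFun x + g.toFun x := rfl

@[simp] theorem Simple.toFun_smul (c : ℂ) (f : μ.Simple) (x : X) :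
    (c • f).toFun x = c * f.toFun x := rfl

theorem Simple.ext {f g : μ.Simple} (h : ∀ x, f.toFun x = g.toFun x) : f = g :=
  Subtype.ext (funext h)

/-- The indicator function of a set of the ring. -/
def Simple.ind (A : Set X) (hA : A ∈ μ.sets) : μ.Simple :=
  ⟨A.indicator 1, by
    classical
    refine ⟨(Set.toFinite ({0, 1} : Set ℂ)).subset ?_, ?_⟩
    · rintro _ ⟨x, rfl⟩
      by_cases hx : x ∈ A <;> simp [hx]
    · intro z hz
      by_cases h1 : z = 1
      · have : (A.indicator (1 : X → ℂ)) ⁻¹' {z} = A := by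
          ext x
          by_cases hx : x ∈ A <;> simp [hx, h1]
        rwa [this]
      · have : (A.indicator (1 : X → ℂ)) ⁻¹' {z} = ∅ := by
          ext x
          by_cases hx : x ∈ A <;> simp [hx, Ne.symm h1, Ne.symm hz]
        rw [this]
        exact μ.isSetRing.empty_mem⟩

variable (μ)

/-- The sesquilinear form `⟨f, g⟩ = ∫ conj f * g dμ` on simple functions; the corresponding seminorm
satisfies `‖f‖ ^ 2 = ∑ z, |z| ^ 2 * μ {f = z}`. -/
abbrev simpleCore : PreInnerProductSpace.Core ℂ μ.Simple where
  inner f g := μ.integral (fun x => (starRingEnd ℂ) (f.toFun x) * g.toFun x)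
  conj_inner_symm f g := by
    have hs := IsSimple.map₂ μ f.isSimple g.isSimple
      (fun y => (starRingEnd ℂ) y.2 * y.1) (by simp)
    have h := IsSimple.integral_map μ hs (starRingEnd ℂ) (by simp)
    have h' := IsSimple.integral_map μ hs id (by simp)
    simp only [id, map_mul, RCLike.conj_conj] at h h'
    rw [h', map_sum]
    simp only [map_mul, Complex.conj_ofReal]
    rw [← h]
    exact congrArg _ (funext fun x => mul_comm _ _)
  re_inner_nonneg f := by
    have h := IsSimple.integral_map μ f.isSimple (fun z => (starRingEnd ℂ) z * z) (by simp)
    rw [h, map_sum]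
    refine Finset.sum_nonneg fun z _ => ?_
    have hz : (μ.m (f.toFun ⁻¹' {z}) : ℂ) * ((starRingEnd ℂ) z * z) =
        ((μ.m (f.toFun ⁻¹' {z}) * Complex.normSq z : ℝ) : ℂ) := by
      rw [mul_comm ((starRingEnd ℂ) z), Complex.mul_conj, Complex.ofReal_mul]
    rw [hz]
    change 0 ≤ μ.m (f.toFun ⁻¹' {z}) * Complex.normSq z
    by_cases h0 : z = 0
    · simp [h0]
    · exact mul_nonneg (μ.nonneg _ (f.isSimple.2 z h0)) (Complex.normSq_nonneg z)
  add_left f g k := by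
    rw [← IsSimple.integral_add μ
      (IsSimple.map₂ μ f.isSimple k.isSimple (fun y => (starRingEnd ℂ) y.1 * y.2) (by simp))
      (IsSimple.map₂ μ g.isSimple k.isSimple (fun y => (starRingEnd ℂ) y.1 * y.2) (by simp))]
    exact congrArg _ (funext fun x => by simp [add_mul])
  smul_left f g c := by
    have hs := IsSimple.map₂ μ f.isSimple g.isSimple
      (fun y => (starRingEnd ℂ) y.1 * y.2) (by simp)
    have h := IsSimple.integral_map μ hs (fun z => (starRingEnd ℂ) c * z) (by simp)
    have h' := IsSimple.integral_map μ hs id (by simp)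
    simp only [id] at h'
    rw [h', Finset.mul_sum]
    have e1 : (fun x => (starRingEnd ℂ) ((c • f).toFun x) * g.toFun x) =
        fun x => (starRingEnd ℂ) c * ((starRingEnd ℂ) (f.toFun x) * g.toFun x) :=
      funext fun x => by simp [mul_assoc]
    rw [e1, h]
    exact Finset.sum_congr rfl fun z _ => by ring

instance : SeminormedAddCommGroup μ.Simple :=
  @InnerProductSpace.Core.toSeminormedAddCommGroup ℂ μ.Simple _ _ _ μ.simpleCore

instance : InnerProductSpace ℂ μ.Simple := InnerProductSpace.ofCore μ.simpleCore

theorem Simple.inner_def (f g : μ.Simple) :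
    inner ℂ f g = μ.integral (fun x => (starRingEnd ℂ) (f.toFun x) * g.toFun x) := rfl

/-- The seminorm on simple functions: `‖f‖ ^ 2 = ∑ |z| ^ 2 * μ {f = z}`. -/
theorem Simple.norm_sq_eq (f : μ.Simple) :
    ‖f‖ ^ 2 = ∑ z ∈ f.isSimple.1.toFinset, ‖z‖ ^ 2 * μ.m (f.toFun ⁻¹' {z}) := by
  rw [@norm_sq_eq_re_inner ℂ, Simple.inner_def,
    IsSimple.integral_map μ f.isSimple (fun z => (starRingEnd ℂ) z * z) (by simp), map_sum]
  refine Finset.sum_congr rfl fun z _ => ?_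
  rw [Complex.conj_mul', ← Complex.ofReal_pow, ← Complex.ofReal_mul, mul_comm]
  rfl

/-- The Hilbert space of (classes of) functions square integrable with respect to `μ`: the
Hausdorff completion of the space of simple functions, i.e. the completion of its quotient by the
functions of zero seminorm. -/
abbrev L2 : Type _ := UniformSpace.Completion μ.Simple

variable {μ}

/-- The composition of a simple function with a map preserving the ring. -/
def Simple.comp (f : μ.Simple) (τ : X → X) (hτ : ∀ A ∈ μ.sets, τ ⁻¹' A ∈ μ.sets) : μ.Simple :=
  ⟨f.toFun ∘ τ, f.isSimple.1.subset (range_comp_subset_range _ _),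
    fun z hz => hτ _ (f.isSimple.2 z hz)⟩

/-- The isometry `f ↦ f ∘ τ` of the space of simple functions, for a measure preserving `τ`. -/
def simpleCompIsometry (τ : X → X) (hτ : μ.Preserves τ) : μ.Simple →ₗᵢ[ℂ] μ.Simple where
  toFun f := f.comp τ hτ.mem
  map_add' _ _ := rfl
  map_smul' _ _ := rfl
  norm_map' f := by
    have key : inner ℂ (f.comp τ hτ.mem) (f.comp τ hτ.mem) = inner ℂ f f := by
      rw [Simple.inner_def, Simple.inner_def]
      unfold integral
      refine finsum_congr fun z => ?_
      by_cases hz : z = 0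
      · simp [hz]
      · congr 2
        exact hτ.m_eq _ ((IsSimple.map₂ μ f.isSimple f.isSimple
          (fun y => (starRingEnd ℂ) y.1 * y.2) (by simp)).2 z hz)
    rw [@norm_eq_sqrt_re_inner ℂ, @norm_eq_sqrt_re_inner ℂ _ _ _ _ f]
    exact congrArg (fun w : ℂ => √(RCLike.re w)) key

/-- The operator `f ↦ f ∘ τ` on the space of square integrable functions. -/
def L2comp (τ : X → X) (hτ : μ.Preserves τ) : μ.L2 →L[ℂ] μ.L2 :=
  (simpleCompIsometry τ hτ).toContinuousLinearMap.completion

end FinAddMeasure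

/-! ### The shift-invariant measure of the orthonormal basis -/

section Blocks

variable {E : Type*} [NormedAddCommGroup E] [InnerProductSpace ℝ E]

/-- The minimal ring of sets containing a given family of sets. -/
def generatedRing {X : Type*} (C : Set (Set X)) : Set (Set X) :=
  {A | ∀ R : Set (Set X), IsSetRing R → C ⊆ R → A ∈ R}

theorem isSetRing_generatedRing {X : Type*} (C : Set (Set X)) : IsSetRing (generatedRing C) where
  empty_mem := fun _ hR _ => hR.empty_mem
  union_mem := fun _ _ hs ht R hR hC => hR.union_mem (hs R hR hC) (ht R hR hC)
  sdiff_mem := fun _ _ hs ht R hR hC => hR.sdiff_mem (hs R hR hC) (ht R hR hC)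

theorem subset_generatedRing {X : Type*} (C : Set (Set X)) : C ⊆ generatedRing C :=
  fun _ hA _ _ hC => hC hA

/-- The block `{x | (e_j, x) ∈ [a_j, b_j) for all j}` with edges collinear to the vectors of
the orthonormal basis `e`. -/
def block (e : HilbertBasis ℕ ℝ E) (a b : ℕ → ℝ) : Set E :=
  {x | ∀ j, inner ℝ (e j) x ∈ Set.Ico (a j) (b j)}

/-- The conditions on the edges of an absolutely measurable block: `a, b ∈ ℓ_∞`, `a_j < b_j`, and
`∑ max {0, ln (b_j - a_j)} < ∞`. -/
structure AbsMeasurableEdges (a b : ℕ → ℝ) : Prop where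
  bdd_left : ∃ C, ∀ j, |a j| ≤ C
  bdd_right : ∃ C, ∀ j, |b j| ≤ C
  lt : ∀ j, a j < b j
  summable : Summable fun j => max 0 (Real.log (b j - a j))

/-- The absolutely measurable blocks, together with the empty set. -/
def absMeasurableBlocks (e : HilbertBasis ℕ ℝ E) : Set (Set E) :=
  {Q | Q = ∅ ∨ ∃ a b, AbsMeasurableEdges a b ∧ Q = block e a b}

/-- The product `∏ (b_j - a_j)` of the edge lengths (it converges for an absolutely measurable
block). -/
def blockVolume (a b : ℕ → ℝ) : ℝ := ∏' j, (b j - a j)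

theorem AbsMeasurableEdges.multipliable {a b : ℕ → ℝ} (h : AbsMeasurableEdges a b) :
    Multipliable fun j => b j - a j := by
  set l : ℕ → ℝ := fun j => Real.log (b j - a j) with hl
  have hpos : ∀ j, 0 < b j - a j := fun j => sub_pos.2 (h.lt j)
  have hf : ∀ s : Finset ℕ, ∏ j ∈ s, (b j - a j) =
      Real.exp (∑ j ∈ s, max 0 (l j)) * Real.exp (-∑ j ∈ s, max 0 (-l j)) := by
    intro s
    rw [← Real.exp_add, ← Finset.sum_neg_distrib, ← Finset.sum_add_distrib, Real.exp_sum]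
    refine Finset.prod_congr rfl fun j _ => ?_
    have : max 0 (l j) + -max 0 (-l j) = l j := by
      rcases le_total 0 (l j) with h0 | h0
      · rw [max_eq_right h0, max_eq_left (by linarith)]; simp
      · rw [max_eq_left h0, max_eq_right (by linarith)]; simp
    rw [this, hl, Real.exp_log (hpos j)]
  have h1 : Tendsto (fun s : Finset ℕ => Real.exp (∑ j ∈ s, max 0 (l j))) atTop
      (𝓝 (Real.exp (∑' j, max 0 (l j)))) :=
    (Real.continuous_exp.tendsto _).comp h.summable.hasSum
  have hmono : Monotone fun s : Finset ℕ => ∑ j ∈ s, max 0 (-l j) := fun s t hst =>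
    Finset.sum_le_sum_of_subset_of_nonneg hst fun j _ _ => le_max_left _ _
  have h2 : ∃ c, Tendsto (fun s : Finset ℕ => Real.exp (-∑ j ∈ s, max 0 (-l j))) atTop (𝓝 c) := by
    rcases tendsto_atTop_of_monotone hmono with h3 | ⟨c, h3⟩
    · exact ⟨0, Real.tendsto_exp_neg_atTop_nhds_zero.comp h3⟩
    · exact ⟨Real.exp (-c), (Real.continuous_exp.tendsto _).comp h3.neg⟩
  obtain ⟨c, hc⟩ := h2
  refine ⟨Real.exp (∑' j, max 0 (l j)) * c, ?_⟩
  change Tendsto (fun s : Finset ℕ => ∏ j ∈ s, (b j - a j)) _ _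
  simp_rw [hf]
  exact h1.mul hc

theorem AbsMeasurableEdges.tendsto {a b : ℕ → ℝ} (h : AbsMeasurableEdges a b) :
    Tendsto (fun N => ∏ j ∈ Finset.range N, (b j - a j)) atTop (𝓝 (blockVolume a b)) :=
  h.multipliable.hasProd.tendsto_prod_nat

theorem block_inter (e : HilbertBasis ℕ ℝ E) (a b a' b' : ℕ → ℝ) :
    block e a b ∩ block e a' b' =
      block e (fun j => max (a j) (a' j)) (fun j => min (b j) (b' j)) := by
  ext x
  simp only [block, mem_inter_iff, Set.mem_ofPred_eq, mem_Ico, max_le_iff, lt_min_iff]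
  rw [← forall_and]
  exact forall_congr' fun j => by tauto

theorem block_lt {e : HilbertBasis ℕ ℝ E} {a b : ℕ → ℝ} (h : (block e a b).Nonempty) (j : ℕ) :
    a j < b j := by
  obtain ⟨x, hx⟩ := h
  exact (hx j).1.trans_lt (hx j).2

theorem AbsMeasurableEdges.inter {e : HilbertBasis ℕ ℝ E} {a b a' b' : ℕ → ℝ}
    (h : AbsMeasurableEdges a b) (h' : AbsMeasurableEdges a' b')
    (hne : (block e a b ∩ block e a' b').Nonempty) :
    AbsMeasurableEdges (fun j => max (a j) (a' j)) (fun j => min (b j) (b' j)) where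
  bdd_left := by
    obtain ⟨C, hC⟩ := h.bdd_left
    obtain ⟨C', hC'⟩ := h'.bdd_left
    exact ⟨max C C', fun j => abs_max_le_max_abs_abs.trans (max_le_max (hC j) (hC' j))⟩
  bdd_right := by
    obtain ⟨C, hC⟩ := h.bdd_right
    obtain ⟨C', hC'⟩ := h'.bdd_right
    exact ⟨max C C', fun j => abs_min_le_max_abs_abs.trans (max_le_max (hC j) (hC' j))⟩
  lt := by
    rw [block_inter] at hne
    exact block_lt hne
  summable := by
    rw [block_inter] at hne
    refine Summable.of_nonneg_of_le (fun _ => le_max_left _ _) (fun j => ?_) h.summable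
    refine max_le_max le_rfl (Real.log_le_log (sub_pos.2 (block_lt hne j)) ?_)
    have h1 := min_le_left (b j) (b' j)
    have h2 := le_max_left (a j) (a' j)
    linarith

theorem AbsMeasurableEdges.shift {a b : ℕ → ℝ} (h : AbsMeasurableEdges a b) {c : ℕ → ℝ}
    (hc : ∃ C, ∀ j, |c j| ≤ C) :
    AbsMeasurableEdges (fun j => a j + c j) (fun j => b j + c j) where
  bdd_left := by
    obtain ⟨C, hC⟩ := h.bdd_left
    obtain ⟨C', hC'⟩ := hc
    exact ⟨C + C', fun j => (abs_add_le _ _).trans (add_le_add (hC j) (hC' j))⟩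
  bdd_right := by
    obtain ⟨C, hC⟩ := h.bdd_right
    obtain ⟨C', hC'⟩ := hc
    exact ⟨C + C', fun j => (abs_add_le _ _).trans (add_le_add (hC j) (hC' j))⟩
  lt j := by have := h.lt j; linarith
  summable := by simpa using h.summable

/-- The pairs `(χ_Q, λ(Q))` for the non-empty absolutely measurable blocks `Q`. -/
def blockPairs (e : HilbertBasis ℕ ℝ E) : Set ((E → ℝ) × ℝ) :=
  {p | ∃ a b, AbsMeasurableEdges a b ∧ (block e a b).Nonempty ∧
    p = ((block e a b).indicator 1, blockVolume a b)}

/-- A choice of a common point of finitely many half-open intervals. -/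
theorem exists_common_coord {ι : Type*} (I : Finset ι) (hI : I.Nonempty) (a b z : ι → ℝ)
    (hz : ∀ i ∈ I, z i ∈ Set.Ico (a i) (b i)) (hab : ∀ i ∈ I, ∀ k ∈ I, a i < b k) :
    ∃ w : ℝ, (∀ i ∈ I, w ∈ Set.Ico (a i) (b i)) ∧ |w| ≤ ∑ i ∈ I, |z i| := by
  have hle : ∀ i ∈ I, |z i| ≤ ∑ i ∈ I, |z i| := fun i hi =>
    Finset.single_le_sum (f := fun i => |z i|) (fun _ _ => abs_nonneg _) hi
  obtain ⟨i₁, hi₁, h₁⟩ := Finset.exists_max_image I a hI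
  obtain ⟨i₂, hi₂, h₂⟩ := Finset.exists_min_image I z hI
  refine ⟨max (a i₁) (z i₂), fun i hi => ⟨(h₁ i hi).trans (le_max_left _ _), ?_⟩, ?_⟩
  · exact max_lt (hab _ hi₁ _ hi) ((h₂ i hi).trans_lt (hz i hi).2)
  · rcases le_total (a i₁) (z i₂) with h | h
    · rw [max_eq_right h]
      exact hle _ hi₂
    · rw [max_eq_left h]
      have e1 := hle _ hi₁
      have e2 := hle _ hi₂
      have e3 := (hz _ hi₁).1
      rw [abs_le]
      constructor
      · have := neg_abs_le (z i₂); linarith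
      · have := le_abs_self (z i₁); linarith

/-- A vector with given coordinates, dominated from some index on by coordinates of vectors. -/
theorem exists_vector (e : HilbertBasis ℕ ℝ E) {ι : Type*} (I : Finset ι) (z : ι → E) (M : ℕ)
    (v : ℕ → ℝ) (hv : ∀ j, M ≤ j → |v j| ≤ ∑ i ∈ I, |inner ℝ (e j) (z i)|) :
    ∃ x : E, ∀ j, inner ℝ (e j) x = v j := by
  have h1 : Memℓp (fun j => ∑ i ∈ I, |inner ℝ (e j) (z i)|) 2 := by
    refine Memℓp.finsetSum I fun i _ => ?_
    have h := memℓp_norm_iff.2 (lp.memℓp (e.repr (z i)))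
    simpa [e.repr_apply_apply] using h
  have h2 : Memℓp (fun j => if j < M then |v j| else 0) 2 := by
    refine memℓp_gen (summable_of_hasFiniteSupport ((Finset.range M).finite_toSet.subset ?_))
    intro j hj
    by_contra h
    have h' : ¬ j < M := by simpa using h
    simp [h'] at hj
  have h3 : Memℓp v 2 := by
    refine Memℓp.mono (h1.add h2) fun j => ?_
    have h0 : 0 ≤ ∑ i ∈ I, |inner ℝ (e j) (z i)| := Finset.sum_nonneg fun _ _ => abs_nonneg _
    by_cases hj : j < M
    · simp [hj, h0]
    · simpa [hj] using hv j (not_lt.1 hj)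
  refine ⟨e.repr.symm ⟨v, h3⟩, fun j => ?_⟩
  rw [← e.repr_apply_apply, LinearIsometryEquiv.apply_symm_apply]

/-- Positivity: a non-negative combination of indicators of blocks has non-negative volume. -/
theorem sum_blockVolume_nonneg (e : HilbertBasis ℕ ℝ E) {n : ℕ} (c : Fin n → ℝ)
    (a b : Fin n → ℕ → ℝ) (hab : ∀ i, AbsMeasurableEdges (a i) (b i))
    (hne : ∀ i, (block e (a i) (b i)).Nonempty)
    (hpos : ∀ x, 0 ≤ ∑ i, c i * (block e (a i) (b i)).indicator (1 : E → ℝ) x) :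
    0 ≤ ∑ i, c i * blockVolume (a i) (b i) := by
  classical
  choose z hz using hne
  -- beyond `N₀`, incompatible blocks have already been separated
  have hN : ∀ i k, ∃ N, (∀ j < N, a i j < b k j) → ∀ j, a i j < b k j := by
    intro i k
    by_cases h : ∀ j, a i j < b k j
    · exact ⟨0, fun _ => h⟩
    · push Not at h
      obtain ⟨j, hj⟩ := h
      exact ⟨j + 1, fun h' => absurd (h' j (Nat.lt_succ_self j)) (not_lt.2 hj)⟩
  choose N hN using hN
  set N₀ := ∑ i, ∑ k, N i k with hN₀
  have hNle : ∀ i k, N i k ≤ N₀ := fun i k =>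
    (Finset.single_le_sum (f := fun k => N i k) (fun _ _ => Nat.zero_le _) (Finset.mem_univ k)).trans
      (Finset.single_le_sum (f := fun i => ∑ k, N i k) (fun _ _ => Nat.zero_le _)
        (Finset.mem_univ i))
  have hlim : Tendsto (fun M => ∑ i, c i * ∏ j ∈ Finset.range M, (b i j - a i j)) atTop
      (𝓝 (∑ i, c i * blockVolume (a i) (b i))) :=
    tendsto_finsetSum _ fun i _ => (hab i).tendsto.const_mul (c i)
  refine ge_of_tendsto hlim ?_
  filter_upwards [eventually_ge_atTop N₀] with M hM
  set Q : Fin n → Set (Fin M → ℝ) := fun i =>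
    Set.univ.pi fun j => Set.Ico (a i j) (b i j) with hQ
  have hQm : ∀ i, MeasurableSet (Q i) := fun i =>
    MeasurableSet.univ_pi fun j => measurableSet_Ico
  have hvol : ∀ i, (volume (Q i)).toReal = ∏ j ∈ Finset.range M, (b i j - a i j) := by
    intro i
    rw [hQ, Real.volume_pi_Ico_toReal (a := fun j : Fin M => a i j) (b := fun j : Fin M => b i j)
      (fun j => ((hab i).lt j).le)]
    exact Fin.prod_univ_eq_prod_range (fun j => b i j - a i j) M
  have hfin : ∀ i, volume (Q i) ≠ ⊤ := by
    intro i
    rw [hQ, Real.volume_pi_Ico]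
    exact ENNReal.prod_ne_top fun _ _ => ENNReal.ofReal_ne_top
  have hint : ∫ y, ∑ i, c i * (Q i).indicator (1 : (Fin M → ℝ) → ℝ) y =
      ∑ i, c i * ∏ j ∈ Finset.range M, (b i j - a i j) := by
    rw [integral_finsetSum]
    · refine Finset.sum_congr rfl fun i _ => ?_
      rw [integral_const_mul, integral_indicator_one (hQm i), Measure.real, hvol]
    · intro i _
      refine Integrable.const_mul ?_ _
      exact (integrable_indicator_iff (hQm i)).2 (integrableOn_const (hfin i))
  rw [← hint]
  refine integral_nonneg fun y => ?_
  set I : Finset (Fin n) := Finset.univ.filter fun i => y ∈ Q i with hI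
  rcases I.eq_empty_or_nonempty with h0 | h0
  · have : ∀ i, y ∉ Q i := fun i hi => by
      have : i ∈ I := by simp [hI, hi]
      rw [h0] at this
      simp at this
    simp [this]
  have hyI : ∀ i ∈ I, ∀ j : Fin M, y j ∈ Set.Ico (a i j) (b i j) := fun i hi j =>
    (Finset.mem_filter.1 hi).2 j (Set.mem_univ j)
  have hlt : ∀ i ∈ I, ∀ k ∈ I, ∀ j, a i j < b k j := by
    intro i hi k hk
    refine hN i k fun j hj => ?_
    have hjM : j < M := hj.trans_le ((hNle i k).trans hM)
    exact (hyI i hi ⟨j, hjM⟩).1.trans_lt (hyI k hk ⟨j, hjM⟩).2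
  have hw : ∀ j, ∃ w : ℝ, (∀ i ∈ I, w ∈ Set.Ico (a i j) (b i j)) ∧
      |w| ≤ ∑ i ∈ I, |inner ℝ (e j) (z i)| := fun j =>
    exists_common_coord I h0 (fun i => a i j) (fun i => b i j) (fun i => inner ℝ (e j) (z i))
      (fun i _ => hz i j) (fun i hi k hk => hlt i hi k hk j)
  choose w hwI hwz using hw
  set v : ℕ → ℝ := fun j => if h : j < M then y ⟨j, h⟩ else w j with hv
  obtain ⟨x, hxj⟩ : ∃ x : E, ∀ j, inner ℝ (e j) x = v j := by
    refine exists_vector e I z M v fun j hj => ?_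
    have hj' : ¬ j < M := not_lt.2 hj
    simpa [hv, hj'] using hwz j
  have hxQ : ∀ i, (x ∈ block e (a i) (b i) ↔ y ∈ Q i) := by
    intro i
    constructor
    · intro h j _
      have := h j
      rw [hxj] at this
      simpa [hv] using this
    · intro h j
      rw [hxj]
      by_cases hj : j < M
      · simpa [hv, hj] using h ⟨j, hj⟩ (Set.mem_univ _)
      · simpa [hv, hj] using hwI j i (by simp [hI, h])
  have := hpos x
  refine this.trans_eq (Finset.sum_congr rfl fun i _ => ?_)
  by_cases h : y ∈ Q i
  · simp [h, (hxQ i).2 h]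
  · have h' : x ∉ block e (a i) (b i) := fun hh => h ((hxQ i).1 hh)
    simp [h, h']


/-- The linear span of the pairs `(χ_Q, λ(Q))`: the graph of the linear functional which extends
the volume of blocks to the linear combinations of their indicators. -/
def volumeGraph (e : HilbertBasis ℕ ℝ E) : Submodule ℝ ((E → ℝ) × ℝ) :=
  Submodule.span ℝ (blockPairs e)

theorem volumeGraph_nonneg (e : HilbertBasis ℕ ℝ E) {f : E → ℝ} {v : ℝ}
    (h : (f, v) ∈ volumeGraph e) (hf : ∀ x, 0 ≤ f x) : 0 ≤ v := by
  obtain ⟨n, c, g, hg⟩ := Submodule.mem_span_set'.1 h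
  have hg' := fun i => (g i).2
  choose a b hab hne hp using hg'
  have h1 : f = ∑ i, c i • (block e (a i) (b i)).indicator (1 : E → ℝ) := by
    have := congrArg Prod.fst hg
    simp only [hp, Prod.fst_sum, Prod.smul_fst] at this
    exact this.symm
  have h2 : v = ∑ i, c i * blockVolume (a i) (b i) := by
    have := congrArg Prod.snd hg
    simp only [hp, Prod.snd_sum, Prod.smul_snd, smul_eq_mul] at this
    exact this.symm
  rw [h2]
  refine sum_blockVolume_nonneg e c a b hab hne fun x => ?_
  have := hf x
  rw [h1] at this
  simpa using this

theorem volumeGraph_unique (e : HilbertBasis ℕ ℝ E) {f : E → ℝ} {v w : ℝ}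
    (h : (f, v) ∈ volumeGraph e) (h' : (f, w) ∈ volumeGraph e) : v = w := by
  have h1 := (volumeGraph e).sub_mem h h'
  have h2 := (volumeGraph e).sub_mem h' h
  simp only [Prod.mk_sub_mk, sub_self] at h1 h2
  have h3 := volumeGraph_nonneg e h1 (fun _ => le_rfl)
  have h4 := volumeGraph_nonneg e h2 (fun _ => le_rfl)
  linarith

theorem volumeGraph_mul (e : HilbertBasis ℕ ℝ E) {p q : (E → ℝ) × ℝ}
    (hp : p ∈ volumeGraph e) (hq : q ∈ volumeGraph e) :
    ∃ v, (p.1 * q.1, v) ∈ volumeGraph e := by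
  induction hp using Submodule.span_induction with
  | zero => exact ⟨0, by rw [Prod.fst_zero, zero_mul]; exact (volumeGraph e).zero_mem⟩
  | add p p' _ _ h h' =>
    obtain ⟨v, hv⟩ := h
    obtain ⟨v', hv'⟩ := h'
    exact ⟨v + v', by simpa [add_mul] using (volumeGraph e).add_mem hv hv'⟩
  | smul c p _ h =>
    obtain ⟨v, hv⟩ := h
    exact ⟨c * v, by simpa using (volumeGraph e).smul_mem c hv⟩
  | mem p hp =>
    induction hq using Submodule.span_induction with
    | zero => exact ⟨0, by rw [Prod.fst_zero, mul_zero]; exact (volumeGraph e).zero_mem⟩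
    | add p p' _ _ h h' =>
      obtain ⟨v, hv⟩ := h
      obtain ⟨v', hv'⟩ := h'
      exact ⟨v + v', by simpa [mul_add] using (volumeGraph e).add_mem hv hv'⟩
    | smul c p _ h =>
      obtain ⟨v, hv⟩ := h
      exact ⟨c * v, by simpa using (volumeGraph e).smul_mem c hv⟩
    | mem q hq =>
      obtain ⟨a, b, hab, -, rfl⟩ := hp
      obtain ⟨a', b', hab', -, rfl⟩ := hq
      have hmul : (block e a b).indicator (1 : E → ℝ) * (block e a' b').indicator 1 =
          (block e a b ∩ block e a' b').indicator 1 := by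
        rw [Set.inter_indicator_one]
      simp only [hmul]
      by_cases hne : (block e a b ∩ block e a' b').Nonempty
      · have hI := hab.inter hab' hne
        rw [block_inter] at hne ⊢
        exact ⟨_, Submodule.subset_span ⟨_, _, hI, hne, rfl⟩⟩
      · rw [not_nonempty_iff_eq_empty] at hne
        rw [hne]
        exact ⟨0, by rw [Set.indicator_empty]; exact (volumeGraph e).zero_mem⟩

theorem exists_volume (e : HilbertBasis ℕ ℝ E) {A : Set E}
    (hA : A ∈ generatedRing (absMeasurableBlocks e)) :
    ∃ v, (A.indicator (1 : E → ℝ), v) ∈ volumeGraph e := by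
  refine hA {A | ∃ v, (A.indicator (1 : E → ℝ), v) ∈ volumeGraph e} ?_ ?_
  · have h0 : ∃ v, ((∅ : Set E).indicator (1 : E → ℝ), v) ∈ volumeGraph e :=
      ⟨0, by rw [Set.indicator_empty]; exact (volumeGraph e).zero_mem⟩
    have hI : ∀ {A B : Set E}, (∃ v, (A.indicator (1 : E → ℝ), v) ∈ volumeGraph e) →
        (∃ v, (B.indicator (1 : E → ℝ), v) ∈ volumeGraph e) →
        ∃ v, ((A ∩ B).indicator (1 : E → ℝ), v) ∈ volumeGraph e := by
      rintro A B ⟨v, hv⟩ ⟨w, hw⟩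
      obtain ⟨u, hu⟩ := volumeGraph_mul e hv hw
      exact ⟨u, by rwa [Set.inter_indicator_one]⟩
    refine ⟨h0, ?_, ?_⟩
    · rintro A B hA hB
      obtain ⟨u, hu⟩ := hI hA hB
      obtain ⟨v, hv⟩ := hA
      obtain ⟨w, hw⟩ := hB
      refine ⟨v + w - u, ?_⟩
      have := (volumeGraph e).sub_mem ((volumeGraph e).add_mem hv hw) hu
      convert this using 1
      refine Prod.ext (funext fun x => ?_) rfl
      by_cases hx : x ∈ A <;> by_cases hx' : x ∈ B <;> simp [hx, hx']
    · rintro A B hA hB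
      obtain ⟨u, hu⟩ := hI hA hB
      obtain ⟨v, hv⟩ := hA
      refine ⟨v - u, ?_⟩
      have := (volumeGraph e).sub_mem hv hu
      convert this using 1
      refine Prod.ext (funext fun x => ?_) rfl
      by_cases hx : x ∈ A <;> by_cases hx' : x ∈ B <;> simp [hx, hx']
  · rintro Q (rfl | ⟨a, b, hab, rfl⟩)
    · exact ⟨0, by rw [Set.indicator_empty]; exact (volumeGraph e).zero_mem⟩
    · by_cases hne : (block e a b).Nonempty
      · exact ⟨_, Submodule.subset_span ⟨a, b, hab, hne, rfl⟩⟩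
      · rw [not_nonempty_iff_eq_empty] at hne
        exact ⟨0, by rw [hne, Set.indicator_empty]; exact (volumeGraph e).zero_mem⟩

open Classical in
/-- The finitely additive measure on the minimal ring containing the absolutely measurable blocks
which extends the volume of blocks. -/
def blockMeasure (e : HilbertBasis ℕ ℝ E) : FinAddMeasure E where
  sets := generatedRing (absMeasurableBlocks e)
  isSetRing := isSetRing_generatedRing _
  m A := if h : ∃ v, (A.indicator (1 : E → ℝ), v) ∈ volumeGraph e then h.choose else 0
  nonneg A hA := by
    have h := exists_volume e hA
    rw [dif_pos h]
    exact volumeGraph_nonneg e h.choose_spec fun x => indicator_nonneg (fun _ _ => zero_le_one) x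
  add A hA B hB hd := by
    have hu := exists_volume e ((isSetRing_generatedRing _).union_mem hA hB)
    have h := exists_volume e hA
    have h' := exists_volume e hB
    rw [dif_pos hu, dif_pos h, dif_pos h']
    refine volumeGraph_unique e hu.choose_spec ?_
    rw [Set.indicator_union_of_disjoint hd]
    exact (volumeGraph e).add_mem h.choose_spec h'.choose_spec

theorem blockMeasure_m_eq (e : HilbertBasis ℕ ℝ E) {A : Set E} {v : ℝ}
    (h : (A.indicator (1 : E → ℝ), v) ∈ volumeGraph e) : (blockMeasure e).m A = v := by
  have h' : ∃ v, (A.indicator (1 : E → ℝ), v) ∈ volumeGraph e := ⟨v, h⟩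
  have : (blockMeasure e).m A = h'.choose := dif_pos h'
  rw [this]
  exact volumeGraph_unique e h'.choose_spec h

/-- The measure of a non-empty absolutely measurable block is the product of its edge lengths. -/
theorem blockMeasure_block (e : HilbertBasis ℕ ℝ E) {a b : ℕ → ℝ} (h : AbsMeasurableEdges a b)
    (hne : (block e a b).Nonempty) :
    block e a b ∈ (blockMeasure e).sets ∧ (blockMeasure e).m (block e a b) = ∏' j, (b j - a j) :=
  ⟨subset_generatedRing _ (Or.inr ⟨a, b, h, rfl⟩),
    blockMeasure_m_eq e (Submodule.subset_span ⟨a, b, h, hne, rfl⟩)⟩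

theorem preimage_sub_block (e : HilbertBasis ℕ ℝ E) (a b : ℕ → ℝ) (h : E) :
    (fun x => x - h) ⁻¹' block e a b =
      block e (fun j => a j + inner ℝ (e j) h) (fun j => b j + inner ℝ (e j) h) := by
  ext x
  simp only [block, mem_preimage, Set.mem_ofPred_eq, mem_Ico, inner_sub_right, le_sub_iff_add_le,
    sub_lt_iff_lt_add]

theorem abs_coord_le (e : HilbertBasis ℕ ℝ E) (h : E) : ∃ C, ∀ j, |inner ℝ (e j) h| ≤ C :=
  ⟨‖h‖, fun j => (abs_real_inner_le_norm _ _).trans (by simp [e.orthonormal.1 j])⟩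

theorem preimage_sub_mem_generatedRing (e : HilbertBasis ℕ ℝ E) (h : E) {A : Set E}
    (hA : A ∈ generatedRing (absMeasurableBlocks e)) :
    (fun x => x - h) ⁻¹' A ∈ generatedRing (absMeasurableBlocks e) := by
  have R := isSetRing_generatedRing (absMeasurableBlocks e)
  refine hA {A | (fun x => x - h) ⁻¹' A ∈ generatedRing (absMeasurableBlocks e)} ?_ ?_
  · exact ⟨R.empty_mem, fun A B hA hB => R.union_mem hA hB, fun A B hA hB => R.sdiff_mem hA hB⟩
  · rintro Q (rfl | ⟨a, b, hab, rfl⟩)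
    · exact R.empty_mem
    · rw [Set.mem_ofPred_eq, preimage_sub_block]
      exact subset_generatedRing _ (Or.inr ⟨_, _, hab.shift (abs_coord_le e h), rfl⟩)

theorem volumeGraph_shift (e : HilbertBasis ℕ ℝ E) (h : E) {p : (E → ℝ) × ℝ}
    (hp : p ∈ volumeGraph e) : ((fun x => p.1 (x - h)), p.2) ∈ volumeGraph e := by
  induction hp using Submodule.span_induction with
  | zero => exact (volumeGraph e).zero_mem
  | add p p' _ _ h h' => exact (volumeGraph e).add_mem h h'
  | smul c p _ h => exact (volumeGraph e).smul_mem c h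
  | mem p hp =>
    obtain ⟨a, b, hab, ⟨y, hy⟩, rfl⟩ := hp
    refine Submodule.subset_span ⟨_, _, hab.shift (abs_coord_le e h), ?_, ?_⟩
    · rw [← preimage_sub_block]
      exact ⟨y + h, by simpa using hy⟩
    · refine Prod.ext ?_ ?_
      · rw [← preimage_sub_block]
        rfl
      · simp [blockVolume]

/-- The measure is invariant under all shifts. -/
theorem blockMeasure_preserves (e : HilbertBasis ℕ ℝ E) (h : E) :
    (blockMeasure e).Preserves (fun x => x - h) where
  mem _ hA := preimage_sub_mem_generatedRing e h hA
  m_eq A hA := by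
    obtain ⟨v, hv⟩ := exists_volume e hA
    rw [blockMeasure_m_eq e hv]
    exact blockMeasure_m_eq e (volumeGraph_shift e h hv)

/-- The shift-invariant measure `λ_e` on the ring `R_e` of `λ_e`-measurable sets. -/
def shiftInvariantMeasure (e : HilbertBasis ℕ ℝ E) : FinAddMeasure E := (blockMeasure e).completion

theorem shiftInvariantMeasure_preserves (e : HilbertBasis ℕ ℝ E) (h : E) :
    (shiftInvariantMeasure e).Preserves (fun x => x - h) :=
  (blockMeasure_preserves e h).completion (blockMeasure_preserves e (-h)) (fun x => by simp)

/-- The Hilbert space `H_e` of functions on `E` square integrable with respect to `λ_e`. -/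
abbrev SquareIntegrable (e : HilbertBasis ℕ ℝ E) : Type _ := (shiftInvariantMeasure e).L2

/-! ### Shifts and their Gaussian averages -/

/-- The shift operator `S_h f (x) = f (x - h)` in the coordinate representation. -/
def coordShift (e : HilbertBasis ℕ ℝ E) (h : E) : SquareIntegrable e →L[ℂ] SquareIntegrable e :=
  FinAddMeasure.L2comp (fun x => x - h) (shiftInvariantMeasure_preserves e h)

/-- Strong operator convergence of a sequence of bounded operators. -/
def StrongLimit {H : Type*} [NormedAddCommGroup H] [InnerProductSpace ℂ H]
    (T : ℕ → H →L[ℂ] H) (S : H →L[ℂ] H) : Prop :=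
  ∀ f, Tendsto (fun n => T n f) atTop (𝓝 (S f))

/-- `T` is the operator of multiplication by the function `φ`: for every set `A` of the ring, the
function `φ χ_A` is a uniform limit of simple functions `s_n` vanishing outside `A`, and the
classes of the `s_n` converge to `T χ_A`. (Since `A` has finite measure, such `s_n` form a Cauchy
sequence whose limit depends only on `φ χ_A`, and the indicators span a dense subspace.) -/
def IsMultiplication (e : HilbertBasis ℕ ℝ E) (φ : E → ℂ)
    (T : SquareIntegrable e →L[ℂ] SquareIntegrable e) : Prop :=
  ∀ (A : Set E) (hA : A ∈ (shiftInvariantMeasure e).sets),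
    ∃ s : ℕ → (shiftInvariantMeasure e).Simple,
      (∀ n, ∀ x ∉ A, (s n).toFun x = 0) ∧
      TendstoUniformly (fun n => (s n).toFun) (A.indicator φ) atTop ∧
      Tendsto (fun n => (s n : SquareIntegrable e)) atTop
        (𝓝 (T (FinAddMeasure.Simple.ind A hA : SquareIntegrable e)))

/-- The orthogonal projection `P_n` onto the span of the first `n` basis vectors. -/
def coordProj (e : HilbertBasis ℕ ℝ E) (n : ℕ) : E →L[ℝ] E :=
  ∑ k ∈ Finset.range n, (innerSL ℝ (e k)).smulRight (e k)

/-- The subspace `L_1(e)` of the vectors with absolutely summable coordinates. -/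
def L1coord (e : HilbertBasis ℕ ℝ E) : Set E := {h | Summable fun k => |inner ℝ (e k) h|}

/-- `T` is the shift `Ŝ_h` in the momentum representation: the strong limit of the operators of
multiplication by `exp (i (P_n h, x))`. -/
def IsMomentumShift (e : HilbertBasis ℕ ℝ E) (h : E)
    (T : SquareIntegrable e →L[ℂ] SquareIntegrable e) : Prop :=
  ∃ T' : ℕ → SquareIntegrable e →L[ℂ] SquareIntegrable e,
    (∀ n, IsMultiplication e
      (fun x => Complex.exp (Complex.I * (inner ℝ (coordProj e n h) x : ℝ))) (T' n)) ∧
    StrongLimit T' T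

/-- `D` is nuclear: `D x = ∑ φ_n(x) y_n` with `∑ ‖φ_n‖ ‖y_n‖ < ∞`. -/
def IsNuclear (D : E →L[ℝ] E) : Prop :=
  ∃ (φ : ℕ → E →L[ℝ] ℝ) (y : ℕ → E), Summable (fun n => ‖φ n‖ * ‖y n‖) ∧
    ∀ x, HasSum (fun n => φ n x • y n) (D x)

variable [MeasurableSpace E]

/-- `ν` is the centered Gaussian measure with covariance operator `D`, i.e. its Fourier transform
is `exp (-(Dξ, ξ) / 2)`. -/
def IsCenteredGaussian (ν : Measure E) (D : E →L[ℝ] E) : Prop :=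
  IsProbabilityMeasure ν ∧
    ∀ ξ, charFun ν ξ = Complex.exp (((-(1 / 2) * inner ℝ (D ξ) ξ : ℝ)) : ℂ)

/-- `A` is the Pettis integral `∫ T_h dν(h)` of the operator-valued function `T`. -/
def IsPettisAverage {H : Type*} [NormedAddCommGroup H] [InnerProductSpace ℂ H]
    (T : E → H →L[ℂ] H) (ν : Measure E) (A : H →L[ℂ] H) : Prop :=
  ∀ f g : H, Integrable (fun h => inner ℂ g (T h f)) ν ∧
    inner ℂ g (A f) = ∫ h, inner ℂ g (T h f) ∂ν

/-- `A` is the operator `U_D = ∫ S_h dν_D(h)`. -/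
def IsCoordAverage (e : HilbertBasis ℕ ℝ E) (D : E →L[ℝ] E)
    (A : SquareIntegrable e →L[ℂ] SquareIntegrable e) : Prop :=
  ∃ ν : Measure E, IsCenteredGaussian ν D ∧ IsPettisAverage (coordShift e) ν A

/-- `A` is the Pettis integral `∫ Ŝ_h dν_D(h)`, where `ν_D` is concentrated on `L_1(e)`. -/
def IsMomentumPettisAverage (e : HilbertBasis ℕ ℝ E) (D : E →L[ℝ] E)
    (A : SquareIntegrable e →L[ℂ] SquareIntegrable e) : Prop :=
  ∃ (ν : Measure E) (T : E → SquareIntegrable e →L[ℂ] SquareIntegrable e),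
    IsCenteredGaussian ν D ∧ (∀ᵐ h ∂ν, h ∈ L1coord e) ∧
    (∀ h ∈ L1coord e, IsMomentumShift e h (T h)) ∧ IsPettisAverage T ν A

/-- `A` is the operator `Û_D`: the strong limit of `Û_{D P_n} = ∫ Ŝ_h dν_{D P_n}(h)`. (It is used
for every nuclear `D`; if `D^{1/2}` is nuclear, it coincides with the Pettis integral
`∫ Ŝ_h dν_D(h)`.) -/
def IsMomentumAverage (e : HilbertBasis ℕ ℝ E) (D : E →L[ℝ] E)
    (A : SquareIntegrable e →L[ℂ] SquareIntegrable e) : Prop :=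
  ∃ A' : ℕ → SquareIntegrable e →L[ℂ] SquareIntegrable e,
    (∀ n, IsMomentumPettisAverage e (D.comp (coordProj e n)) (A' n)) ∧ StrongLimit A' A

end Blocks

end

noncomputable section

open MeasureTheory Filter Topology Set

/-! ### Simple functions, their seminorm, and multiplication by sampled functions. -/

namespace FinAddMeasure

variable {X Y : Type*} {μ : FinAddMeasure X}

/-! A single operator separates the two families: the diagonal $D$ with eigenvalues $d_k =
1/(k+1)^2$. Its trace is finite, but $\sum_k \sqrt{d_k}$ diverges. For this $D$ and every $t > 0$
the averaged shift $\mathcal U_{tD}$ is zero, while $\widehat{\mathcal U}_{tD}$ is multiplication by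
a strictly positive function and is not zero. No unitary conjugates a nonzero operator to zero, so
$t = 1$ already gives the contradiction.

Vanishing. A vector $h$ distributed by $\nu_{tD}$ has independent coordinates $\sqrt{t
d_k}\,\omega_k$ with standard Gaussian $\omega_k$. A Laplace transform estimate shows that $\sum_k
|h_k + \delta_k| = \infty$ almost surely for each fixed sequence $\delta$
(`ae_not_summable_gaussianProduct`). Two absolutely measurable blocks whose centers differ by a
sequence outside $\ell_1$ meet in a null set: each side of the intersection is shortened by the
distance of the centers, and the product of the lengths tends to zero (`blockVolume_inter_eq_zero`).
Every measurable set is covered by finitely many blocks, so for fixed simple $f, g$ the functions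
$S_h f$ and $g$ are orthogonal for almost every $h$, and the average is zero
(`isPettisAverage_coordShift_zero`).

Non-vanishing. A simple function lives on vectors with uniformly bounded coordinates. There
characters with $\ell_1$ frequency, and Gaussian weights with summable coefficients, are uniform
limits of their values at rounded vectors. On a measurable set the rounded vector takes finitely
many values, so matrix elements of sampled multiplications are finite sums, and averaging over $h$
acts pointwise on the symbol (`isPettisAverage_mulOp`). Hence the average of characters is
multiplication by the characteristic function of the Gaussian measure, and in the limit
$\widehat{\mathcal U}_{tD}$ is multiplication by $\exp(-\frac t2 \sum_k d_k x_k^2)$. On the unit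
cube this is at least $\exp(-\frac t2 \sum_k d_k) > 0$ (`mulOp_gaussianWeight_ne_zero`). -/

theorem Simple.toFun_sum {ι : Type*} (T : Finset ι) (f : ι → μ.Simple) (x : X) :
    (∑ i ∈ T, f i).toFun x = ∑ i ∈ T, (f i).toFun x := by
  classical
  induction T using Finset.induction_on with
  | empty => rfl
  | insert a T ha ih => rw [Finset.sum_insert ha, Finset.sum_insert ha, Simple.toFun_add, ih]

/-- The seminorm of simple functions is monotone. -/
theorem Simple.norm_le_of_le {f g : μ.Simple} (h : ∀ x, ‖f.toFun x‖ ≤ ‖g.toFun x‖) :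
    ‖f‖ ≤ ‖g‖ := by
  obtain ⟨T, hT, hp⟩ := IsSimple.pair μ f.isSimple g.isSimple
  refine le_of_sq_le_sq ?_ (norm_nonneg _)
  have hc : ∀ z : ℂ, (starRingEnd ℂ) z * z = ((‖z‖ ^ 2 : ℝ) : ℂ) := fun z => by
    rw [Complex.conj_mul', Complex.ofReal_pow]
  have hf : ‖f‖ ^ 2 = ∑ y ∈ T, μ.m ((fun x => (f.toFun x, g.toFun x)) ⁻¹' {y}) * ‖y.1‖ ^ 2 := by
    rw [@norm_sq_eq_re_inner ℂ, Simple.inner_def,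
      μ.integral_comp hT (0, 0) hp (fun y => (starRingEnd ℂ) y.1 * y.1) (by simp), map_sum]
    refine Finset.sum_congr rfl fun y _ => ?_
    rw [hc, ← Complex.ofReal_mul]
    rfl
  have hg : ‖g‖ ^ 2 = ∑ y ∈ T, μ.m ((fun x => (f.toFun x, g.toFun x)) ⁻¹' {y}) * ‖y.2‖ ^ 2 := by
    rw [@norm_sq_eq_re_inner ℂ, Simple.inner_def,
      μ.integral_comp hT (0, 0) hp (fun y => (starRingEnd ℂ) y.2 * y.2) (by simp), map_sum]
    refine Finset.sum_congr rfl fun y _ => ?_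
    rw [hc, ← Complex.ofReal_mul]
    rfl
  rw [hf, hg]
  refine Finset.sum_le_sum fun y _ => ?_
  by_cases hy : y = (0, 0)
  · simp [hy]
  rcases ((fun x => (f.toFun x, g.toFun x)) ⁻¹' {y}).eq_empty_or_nonempty with h0 | ⟨x, hx⟩
  · simp [h0, μ.m_empty]
  · have hx' : (f.toFun x, g.toFun x) = y := hx
    have := h x
    have hle : ‖y.1‖ ≤ ‖y.2‖ := by simpa [← hx'] using this
    exact mul_le_mul_of_nonneg_left (by gcongr) (μ.nonneg _ (hp y hy))

theorem Simple.norm_le_mul_of_le {f g : μ.Simple} {c : ℝ} (hc : 0 ≤ c)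
    (h : ∀ x, ‖f.toFun x‖ ≤ c * ‖g.toFun x‖) : ‖f‖ ≤ c * ‖g‖ := by
  have h1 : ‖f‖ ≤ ‖(c : ℂ) • g‖ := Simple.norm_le_of_le fun x => by
    rw [Simple.toFun_smul, norm_mul, Complex.norm_real, Real.norm_of_nonneg hc]
    exact h x
  rwa [norm_smul, Complex.norm_real, Real.norm_of_nonneg hc] at h1

theorem Simple.norm_ind_sq (A : Set X) (hA : A ∈ μ.sets) : ‖Simple.ind A hA‖ ^ 2 = μ.m A := by
  classical
  have h := μ.integral_comp (p := fun x => decide (x ∈ A)) (T := Finset.univ)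
    (fun x => Finset.mem_univ _) false (by
      intro y hy
      have : y = true := by simpa using hy
      subst this
      have : (fun x => decide (x ∈ A)) ⁻¹' {true} = A := by ext x; simp
      rwa [this]) (fun y => if y then 1 else 0) (by simp)
  rw [@norm_sq_eq_re_inner ℂ, Simple.inner_def]
  have e : (fun x => (starRingEnd ℂ) ((Simple.ind A hA).toFun x) * (Simple.ind A hA).toFun x) =
      fun x => if decide (x ∈ A) then 1 else 0 := by
    ext x
    by_cases hx : x ∈ A <;> simp [Simple.ind, Simple.toFun, hx]
  rw [e, h]
  have : (fun x => decide (x ∈ A)) ⁻¹' {true} = A := by ext x; simp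
  simp [this]

theorem Simple.support_mem (f : μ.Simple) : Function.support f.toFun ∈ μ.sets := by
  classical
  have : Function.support f.toFun =
      ⋃ z ∈ f.isSimple.1.toFinset.filter (fun z => z ≠ 0), f.toFun ⁻¹' {z} := by
    ext x; simp
  rw [this]
  exact μ.isSetRing.biUnion_mem _ fun z hz => f.isSimple.2 z (Finset.mem_filter.1 hz).2

/-- The restriction of a simple function to a set whose traces on the ring lie in the ring. -/
def Simple.restrict (f : μ.Simple) (B : Set X) (hB : ∀ A ∈ μ.sets, A ∩ B ∈ μ.sets) : μ.Simple :=
  ⟨B.indicator f.toFun, by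
    refine ⟨(f.isSimple.1.insert 0).subset ?_, fun z hz => ?_⟩
    · rintro _ ⟨x, rfl⟩
      by_cases hx : x ∈ B <;> simp [hx]
    · have : B.indicator f.toFun ⁻¹' {z} = f.toFun ⁻¹' {z} ∩ B := by
        ext x
        by_cases hx : x ∈ B <;> simp [hx, hz.symm]
      rw [this]
      exact hB _ (f.isSimple.2 z hz)⟩

theorem Simple.restrict_toFun (f : μ.Simple) (B : Set X) (hB : ∀ A ∈ μ.sets, A ∩ B ∈ μ.sets) :
    (f.restrict B hB).toFun = B.indicator f.toFun := rfl

variable (μ) in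
/-- `r` takes finitely many values on every set of the ring, and its level sets have traces on the
ring in the ring. -/
structure IsSampling (r : X → Y) : Prop where
  finite_image : ∀ A ∈ μ.sets, (r '' A).Finite
  inter_mem : ∀ y, ∀ A ∈ μ.sets, A ∩ r ⁻¹' {y} ∈ μ.sets

/-- The support of `f` lies in the ring, so `r` takes only finitely many values on it and `f` splits
into its restrictions to the level sets of `r`. The index set and the pieces do not depend on `φ`.
-/
theorem IsSampling.mul_eq_sum {r : X → Y} (hr : μ.IsSampling r) (φ : Y → ℂ) (f : μ.Simple) (x : X) :
    φ (r x) * f.toFun x =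
      (∑ y ∈ (hr.finite_image _ f.support_mem).toFinset,
        φ y • f.restrict (r ⁻¹' {y}) (hr.inter_mem y)).toFun x := by
  classical
  rw [Simple.toFun_sum]
  simp only [Simple.toFun_smul, Simple.restrict_toFun]
  by_cases hx : f.toFun x = 0
  · rw [hx, mul_zero, Finset.sum_eq_zero]
    intro y _
    simp [Set.indicator_apply, hx]
  · rw [Finset.sum_eq_single (r x)]
    · simp
    · intro y _ hy
      simp [hy.symm]
    · intro h
      exact absurd (by simpa using ⟨x, hx, rfl⟩) h

/-- Multiplication of simple functions by `φ ∘ r` for a sampling map `r`. -/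
def IsSampling.mul {r : X → Y} (hr : μ.IsSampling r) (φ : Y → ℂ) : μ.Simple →ₗ[ℂ] μ.Simple where
  toFun f := ⟨fun x => φ (r x) * f.toFun x, by
    rw [funext (hr.mul_eq_sum φ f)]
    exact Simple.isSimple _⟩
  map_add' f g := Simple.ext fun x => mul_add _ _ _
  map_smul' c f := Simple.ext fun x => mul_left_comm _ _ _

theorem IsSampling.mul_toFun {r : X → Y} (hr : μ.IsSampling r) (φ : Y → ℂ) (f : μ.Simple) (x : X) :
    (hr.mul φ f).toFun x = φ (r x) * f.toFun x := rfl

/-- The matrix element is a fixed finite linear combination of values of `φ`. If `φ` depends on a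
parameter, measurability and integration in the parameter therefore reduce to those of finitely many
scalars. -/
theorem IsSampling.inner_mul {r : X → Y} (hr : μ.IsSampling r) (φ : Y → ℂ) (f g : μ.Simple) :
    inner ℂ g (hr.mul φ f) = ∑ y ∈ (hr.finite_image _ f.support_mem).toFinset,
      φ y * inner ℂ g (f.restrict (r ⁻¹' {y}) (hr.inter_mem y)) := by
  have : hr.mul φ f = _ := Simple.ext (hr.mul_eq_sum φ f)
  rw [this, inner_sum]
  simp only [inner_smul_right]

/-- The operator of multiplication by `φ ∘ r`, where `r` is a sampling map and `|φ| ≤ 1`. -/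
def IsSampling.mulL {r : X → Y} (hr : μ.IsSampling r) (φ : Y → ℂ) (hφ : ∀ y, ‖φ y‖ ≤ 1) :
    μ.L2 →L[ℂ] μ.L2 :=
  ((hr.mul φ).mkContinuous 1 fun f => Simple.norm_le_mul_of_le zero_le_one fun x => by
    rw [hr.mul_toFun, norm_mul]
    exact mul_le_mul_of_nonneg_right (hφ _) (norm_nonneg _)).completion

theorem IsSampling.mulL_coe {r : X → Y} (hr : μ.IsSampling r) (φ : Y → ℂ) (hφ : ∀ y, ‖φ y‖ ≤ 1)
    (f : μ.Simple) : hr.mulL φ hφ (f : μ.L2) = (hr.mul φ f : μ.Simple) := by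
  unfold IsSampling.mulL
  rw [ContinuousLinearMap.completion_apply_coe]
  rfl

theorem L2.norm_apply_le_of_coe {T : μ.L2 →L[ℂ] μ.L2}
    (h : ∀ f : μ.Simple, ‖T (f : μ.L2)‖ ≤ ‖(f : μ.L2)‖) (f : μ.L2) : ‖T f‖ ≤ ‖f‖ := by
  induction f using UniformSpace.Completion.induction_on with
  | hp => exact isClosed_le (by fun_prop) (by fun_prop)
  | ih f => exact h f

theorem IsSampling.norm_mulL_le {r : X → Y} (hr : μ.IsSampling r) (φ : Y → ℂ)
    (hφ : ∀ y, ‖φ y‖ ≤ 1) (f : μ.L2) : ‖hr.mulL φ hφ f‖ ≤ ‖f‖ := by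
  refine L2.norm_apply_le_of_coe (fun f => ?_) f
  rw [hr.mulL_coe, UniformSpace.Completion.norm_coe, UniformSpace.Completion.norm_coe]
  refine Simple.norm_le_of_le fun x => ?_
  rw [hr.mul_toFun, norm_mul]
  exact mul_le_of_le_one_left (norm_nonneg _) (hφ _)

theorem Simple.norm_comp {τ : X → X} (hτ : μ.Preserves τ) (f : μ.Simple) :
    ‖f.comp τ hτ.mem‖ = ‖f‖ := (simpleCompIsometry τ hτ).norm_map f

theorem L2comp_coe {τ : X → X} (hτ : μ.Preserves τ) (f : μ.Simple) :
    L2comp τ hτ (f : μ.L2) = (f.comp τ hτ.mem : μ.Simple) := by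
  unfold L2comp
  rw [ContinuousLinearMap.completion_apply_coe]
  rfl

theorem norm_L2comp_le {τ : X → X} (hτ : μ.Preserves τ) (f : μ.L2) : ‖L2comp τ hτ f‖ ≤ ‖f‖ := by
  refine L2.norm_apply_le_of_coe (fun f => ?_) f
  rw [L2comp_coe, UniformSpace.Completion.norm_coe, UniformSpace.Completion.norm_coe,
    Simple.norm_comp hτ]

/-- Simple functions whose supports meet in a null set are orthogonal. -/
theorem Simple.inner_eq_zero {f g : μ.Simple}
    (h : μ.m (Function.support g.toFun ∩ Function.support f.toFun) = 0) : inner ℂ g f = 0 := by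
  have hs := IsSimple.map₂ μ g.isSimple f.isSimple
    (fun y => (starRingEnd ℂ) y.1 * y.2) (by simp)
  rw [Simple.inner_def]
  unfold integral
  rw [finsum_eq_zero_of_forall_eq_zero]
  intro z
  by_cases hz : z = 0
  · rw [hz, mul_zero]
  have hm := hs.2 z hz
  have h1 := μ.nonneg _ hm
  have h2 := μ.m_mono hm (μ.isSetRing.inter_mem g.support_mem f.support_mem) (by
    intro x hx
    have hx' : (starRingEnd ℂ) (g.toFun x) * f.toFun x = z := hx
    constructor <;> intro h0 <;> exact hz (by simp [← hx', h0]))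
  have h3 := le_antisymm (h ▸ h2) h1
  simp only at h3
  rw [h3]
  simp

end FinAddMeasure

/-! ### Strong limits and Pettis averages of contractions, checked on dense sets. -/

section Hilbert

variable {H : Type*} [NormedAddCommGroup H] [InnerProductSpace ℂ H]

theorem strongLimit_of_dense {T : ℕ → H →L[ℂ] H} {S : H →L[ℂ] H} (hT : ∀ n f, ‖T n f‖ ≤ ‖f‖)
    (hS : ∀ f, ‖S f‖ ≤ ‖f‖) {s : Set H} (hs : Dense s)
    (h : ∀ f ∈ s, Tendsto (fun n => T n f) atTop (𝓝 (S f))) : StrongLimit T S := by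
  intro f
  rw [Metric.tendsto_atTop]
  intro ε hε
  obtain ⟨g, hg, hfg⟩ := Metric.dense_iff.1 hs f (ε / 3) (by positivity)
  obtain ⟨N, hN⟩ := Metric.tendsto_atTop.1 (h g hfg) (ε / 3) (by positivity)
  refine ⟨N, fun n hn => ?_⟩
  have hd : ‖g - f‖ < ε / 3 := by simpa [dist_eq_norm] using hg
  have h1 : dist (T n f) (T n g) ≤ ‖g - f‖ := by
    rw [dist_comm, dist_eq_norm, ← map_sub]; exact hT n _
  have h2 : dist (S g) (S f) ≤ ‖g - f‖ := by
    rw [dist_eq_norm, ← map_sub]; exact hS _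
  have h3 := hN n hn
  have := dist_triangle4 (T n f) (T n g) (S g) (S f)
  linarith

theorem exists_strongLimit [CompleteSpace H] {T : ℕ → H →L[ℂ] H} (hT : ∀ n f, ‖T n f‖ ≤ ‖f‖)
    {s : Set H} (hs : Dense s) (h : ∀ f ∈ s, CauchySeq fun n => T n f) :
    ∃ S : H →L[ℂ] H, StrongLimit T S ∧ ∀ f, ‖S f‖ ≤ ‖f‖ := by
  have hc : ∀ f, CauchySeq fun n => T n f := by
    intro f
    rw [Metric.cauchySeq_iff']
    intro ε hε
    obtain ⟨g, hg, hfg⟩ := Metric.dense_iff.1 hs f (ε / 3) (by positivity)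
    obtain ⟨N, hN⟩ := Metric.cauchySeq_iff'.1 (h g hfg) (ε / 3) (by positivity)
    refine ⟨N, fun n hn => ?_⟩
    have hd : ‖g - f‖ < ε / 3 := by simpa [dist_eq_norm] using hg
    have h1 : dist (T n f) (T n g) ≤ ‖g - f‖ := by
      rw [dist_comm, dist_eq_norm, ← map_sub]; exact hT n _
    have h2 : dist (T N g) (T N f) ≤ ‖g - f‖ := by
      rw [dist_eq_norm, ← map_sub]; exact hT N _
    have h3 := hN n hn
    have := dist_triangle4 (T n f) (T n g) (T N g) (T N f)
    linarith
  choose S hS using fun f => cauchySeq_tendsto_of_complete (hc f)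
  exact ⟨continuousLinearMapOfTendsto T (tendsto_pi_nhds.2 hS), hS, fun f =>
    le_of_tendsto (hS f).norm (Eventually.of_forall fun n => hT n f)⟩

/-- It suffices to check a Pettis average of contractions on a dense set of vectors. -/
theorem isPettisAverage_of_dense {E : Type*} [NormedAddCommGroup E] [InnerProductSpace ℝ E]
    [MeasurableSpace E] {T : E → H →L[ℂ] H} {ν : Measure E} [IsFiniteMeasure ν] {A : H →L[ℂ] H}
    (hT : ∀ h f, ‖T h f‖ ≤ ‖f‖) {s : Set H} (hs : Dense s)
    (hfg : ∀ f ∈ s, ∀ g ∈ s, Integrable (fun h => inner ℂ g (T h f)) ν ∧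
      inner ℂ g (A f) = ∫ h, inner ℂ g (T h f) ∂ν) : IsPettisAverage T ν A := by
  -- The good pairs form a closed set: the contractions give a bound uniform in `h` along a
  -- convergent sequence of pairs, so dominated convergence passes integrability and the identity to
  -- the limit.
  have hcl : IsClosed {p : H × H | Integrable (fun h => inner ℂ p.2 (T h p.1)) ν ∧
      inner ℂ p.2 (A p.1) = ∫ h, inner ℂ p.2 (T h p.1) ∂ν} := by
    refine IsSeqClosed.isClosed fun u p hu hp => ?_
    have hp1 : Tendsto (fun n => (u n).1) atTop (𝓝 p.1) := (continuous_fst.tendsto p).comp hp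
    have hp2 : Tendsto (fun n => (u n).2) atTop (𝓝 p.2) := (continuous_snd.tendsto p).comp hp
    obtain ⟨C, hC⟩ := (Metric.isBounded_range_of_tendsto _ hp).exists_norm_le
    have hC' : ∀ n, ‖(u n).1‖ ≤ C ∧ ‖(u n).2‖ ≤ C := fun n =>
      ⟨(norm_fst_le _).trans (hC _ ⟨n, rfl⟩), (norm_snd_le _).trans (hC _ ⟨n, rfl⟩)⟩
    have hC0 : 0 ≤ C := (norm_nonneg _).trans (hC' 0).1
    have hlim : ∀ h, Tendsto (fun n => inner ℂ (u n).2 (T h (u n).1)) atTop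
        (𝓝 (inner ℂ p.2 (T h p.1))) := fun h =>
      hp2.inner (((T h).continuous.tendsto _).comp hp1)
    have hbd : ∀ n h, ‖inner ℂ (u n).2 (T h (u n).1)‖ ≤ C * C := fun n h =>
      (norm_inner_le_norm _ _).trans
        (mul_le_mul (hC' n).2 ((hT _ _).trans (hC' n).1) (norm_nonneg _) hC0)
    have hm := aestronglyMeasurable_of_tendsto_ae atTop (fun n => (hu n).1.aestronglyMeasurable)
      (Eventually.of_forall hlim)
    refine ⟨Integrable.mono' (integrable_const (C * C)) hm (Eventually.of_forall fun h =>
      le_of_tendsto (hlim h).norm (Eventually.of_forall fun n => hbd n h)), ?_⟩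
    have h1 := tendsto_integral_of_dominated_convergence (fun _ => C * C)
      (fun n => (hu n).1.aestronglyMeasurable) (integrable_const _)
      (fun n => Eventually.of_forall (hbd n)) (Eventually.of_forall hlim)
    simp only [fun n => (hu n).2.symm] at h1
    exact tendsto_nhds_unique (hp2.inner ((A.continuous.tendsto _).comp hp1)) h1
  intro f g
  have hd : (s ×ˢ s : Set (H × H)) ⊆ _ := fun p hp => hfg p.1 hp.1 p.2 hp.2
  have := hcl.closure_subset_iff.2 hd
  rw [(hs.prod hs).closure_eq] at this
  exact this (Set.mem_univ (f, g))

end Hilbert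

/-! ### Block covers, slabs and the rounding of coordinates. -/

section Sampling

variable {E : Type*} [NormedAddCommGroup E] [InnerProductSpace ℝ E]

theorem HilbertBasis.ext_coord (e : HilbertBasis ℕ ℝ E) {x y : E}
    (h : ∀ j, inner ℝ (e j) x = inner ℝ (e j) y) : x = y :=
  e.repr.injective (lp.ext (funext fun j => by simpa [e.repr_apply_apply] using h j))

theorem abs_coord_le_norm (e : HilbertBasis ℕ ℝ E) (x : E) (j : ℕ) : |inner ℝ (e j) x| ≤ ‖x‖ :=
  (abs_real_inner_le_norm _ _).trans (by simp [e.orthonormal.1 j])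

theorem inner_basis (e : HilbertBasis ℕ ℝ E) (j k : ℕ) :
    inner ℝ (e j) (e k) = if j = k then (1 : ℝ) else 0 :=
  orthonormal_iff_ite.1 e.orthonormal j k

theorem inner_sum_smul_basis (e : HilbertBasis ℕ ℝ E) (c : ℕ → ℝ) (m j : ℕ) :
    inner ℝ (e j) (∑ k ∈ Finset.range m, c k • e k) = if j < m then c j else 0 := by
  simp [inner_sum, inner_smul_right, inner_basis]

theorem inner_coordProj (e : HilbertBasis ℕ ℝ E) (n j : ℕ) (x : E) :
    inner ℝ (e j) (coordProj e n x) = if j < n then inner ℝ (e j) x else 0 := by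
  rw [← inner_sum_smul_basis e (fun k => inner ℝ (e k) x) n j]
  simp [coordProj]

/-- The sets with such a cover form a ring, since a difference is covered by any cover of its first
set. This ring contains the blocks, hence the minimal ring. -/
theorem exists_block_cover_of_mem_generatedRing (e : HilbertBasis ℕ ℝ E) {A : Set E}
    (hA : A ∈ generatedRing (absMeasurableBlocks e)) :
    ∃ T : Finset ((ℕ → ℝ) × (ℕ → ℝ)), (∀ p ∈ T, AbsMeasurableEdges p.1 p.2) ∧
      A ⊆ ⋃ p ∈ T, block e p.1 p.2 := by
  classical
  refine hA {A | ∃ T : Finset ((ℕ → ℝ) × (ℕ → ℝ)), (∀ p ∈ T, AbsMeasurableEdges p.1 p.2) ∧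
      A ⊆ ⋃ p ∈ T, block e p.1 p.2} ⟨⟨∅, by simp, by simp⟩, ?_, ?_⟩ ?_
  · rintro A B ⟨T, hT, hA⟩ ⟨T', hT', hB⟩
    refine ⟨T ∪ T', fun p hp => (Finset.mem_union.1 hp).elim (hT p) (hT' p), ?_⟩
    rw [Finset.set_biUnion_union]
    exact union_subset_union hA hB
  · rintro A B ⟨T, hT, hA⟩ -
    exact ⟨T, hT, sdiff_subset.trans hA⟩
  · rintro Q (rfl | ⟨a, b, hab, rfl⟩)
    · exact ⟨∅, by simp, by simp⟩
    · exact ⟨{(a, b)}, by simpa using hab, by simp⟩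

/-- Every measurable set is covered by finitely many absolutely measurable blocks. -/
theorem exists_block_cover (e : HilbertBasis ℕ ℝ E) {A : Set E}
    (hA : A ∈ (shiftInvariantMeasure e).sets) :
    ∃ T : Finset ((ℕ → ℝ) × (ℕ → ℝ)), (∀ p ∈ T, AbsMeasurableEdges p.1 p.2) ∧
      A ⊆ ⋃ p ∈ T, block e p.1 p.2 := by
  obtain ⟨B, -, C, hC, -, hAC, -⟩ := hA 1 one_pos
  obtain ⟨T, hT, hCT⟩ := exists_block_cover_of_mem_generatedRing e hC
  exact ⟨T, hT, hAC.trans hCT⟩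

/-- The set of the vectors whose coordinates are bounded by `C`. -/
def coordBox (e : HilbertBasis ℕ ℝ E) (C : ℝ) : Set E := {x | ∀ j, |inner ℝ (e j) x| ≤ C}

/-- The edges of a block lie in $\ell_\infty$, and finitely many blocks suffice for a cover.
Consequently only uniform convergence on the sets `coordBox e C` matters for multiplication
operators. -/
theorem exists_subset_coordBox (e : HilbertBasis ℕ ℝ E) {A : Set E}
    (hA : A ∈ (shiftInvariantMeasure e).sets) : ∃ C, A ⊆ coordBox e C := by
  obtain ⟨T, hT, hAT⟩ := exists_block_cover e hA
  have h : ∀ p ∈ T, ∃ C, 0 ≤ C ∧ block e p.1 p.2 ⊆ coordBox e C := by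
    intro p hp
    obtain ⟨c, hc⟩ := (hT p hp).bdd_left
    obtain ⟨d, hd⟩ := (hT p hp).bdd_right
    refine ⟨max c d, ((abs_nonneg _).trans (hc 0)).trans (le_max_left _ _), fun x hx j => ?_⟩
    have h1 := hx j
    have h2 := abs_le.1 (hc j)
    have h3 := abs_le.1 (hd j)
    rw [abs_le]
    constructor
    · linarith [h1.1, le_max_left c d]
    · linarith [h1.2, le_max_right c d]
  choose! C hC0 hC using h
  refine ⟨∑ p ∈ T, C p, fun x hx j => ?_⟩
  obtain ⟨p, hp, hxp⟩ := mem_iUnion₂.1 (hAT hx)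
  exact (hC p hp hxp j).trans (Finset.single_le_sum (fun q hq => hC0 q hq) hp)

/-- The slab of the vectors whose `j`-th coordinate lies in `[α, β)`. -/
def coordSlab (e : HilbertBasis ℕ ℝ E) (j : ℕ) (α β : ℝ) : Set E :=
  {x | inner ℝ (e j) x ∈ Set.Ico α β}

/-- Inside the block, the slab may be replaced by the block with the `j`-th edge changed to `[α,
β)`. Only one edge changes, so boundedness and summability persist, and a point of the intersection
supplies `α < β`. -/
theorem block_inter_coordSlab_mem (e : HilbertBasis ℕ ℝ E) {a b : ℕ → ℝ}
    (h : AbsMeasurableEdges a b) (j : ℕ) (α β : ℝ) :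
    block e a b ∩ coordSlab e j α β ∈ generatedRing (absMeasurableBlocks e) := by
  classical
  refine subset_generatedRing _ ?_
  rcases (block e a b ∩ coordSlab e j α β).eq_empty_or_nonempty with h0 | hne
  · exact Or.inl h0
  set a' := Function.update a j α with ha'
  set b' := Function.update b j β with hb'
  have e1 : block e a b ∩ coordSlab e j α β = block e a b ∩ block e a' b' := by
    ext x
    refine and_congr_right fun hx => ⟨fun hs i => ?_, fun hs => ?_⟩
    · by_cases hij : i = j
      · subst hij; simpa [ha', hb', coordSlab] using hs
      · simpa [ha', hb', hij] using hx i
    · simpa [ha', hb', coordSlab] using hs j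
  rw [e1] at hne ⊢
  have h' : AbsMeasurableEdges a' b' := by
    obtain ⟨x, -, hx⟩ := hne
    refine ⟨?_, ?_, fun i => (hx i).1.trans_lt (hx i).2, ?_⟩
    · obtain ⟨C, hC⟩ := h.bdd_left
      refine ⟨max C |α|, fun i => ?_⟩
      by_cases hij : i = j
      · subst hij; simp [ha']
      · simp [ha', hij, hC i]
    · obtain ⟨C, hC⟩ := h.bdd_right
      refine ⟨max C |β|, fun i => ?_⟩
      by_cases hij : i = j
      · subst hij; simp [hb']
      · simp [hb', hij, hC i]
    · have := h.summable.update j (max 0 (Real.log (β - α)))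
      refine (summable_congr fun i => ?_).1 this
      by_cases hij : i = j
      · subst hij; simp [ha', hb']
      · simp [ha', hb', hij]
  refine Or.inr ⟨_, _, h.inter h' hne, block_inter e a b a' b'⟩

theorem inter_coordSlab_mem_generatedRing (e : HilbertBasis ℕ ℝ E) (j : ℕ) (α β : ℝ) {A : Set E}
    (hA : A ∈ generatedRing (absMeasurableBlocks e)) :
    A ∩ coordSlab e j α β ∈ generatedRing (absMeasurableBlocks e) := by
  have R := isSetRing_generatedRing (absMeasurableBlocks e)
  refine hA {A | A ∩ coordSlab e j α β ∈ generatedRing (absMeasurableBlocks e)} ⟨?_, ?_, ?_⟩ ?_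
  · simpa using R.empty_mem
  · intro A B hA hB
    rw [Set.mem_ofPred_eq, union_inter_distrib_right]
    exact R.union_mem hA hB
  · intro A B hA hB
    have : (A \ B) ∩ coordSlab e j α β = (A ∩ coordSlab e j α β) \ (B ∩ coordSlab e j α β) := by
      ext x; simp only [mem_inter_iff, Set.mem_sdiff]; tauto
    rw [Set.mem_ofPred_eq, this]
    exact R.sdiff_mem hA hB
  · rintro Q (rfl | ⟨a, b, hab, rfl⟩)
    · simpa using R.empty_mem
    · exact block_inter_coordSlab_mem e hab j α β

theorem inter_coordSlab_mem (e : HilbertBasis ℕ ℝ E) (j : ℕ) (α β : ℝ) {A : Set E}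
    (hA : A ∈ (shiftInvariantMeasure e).sets) :
    A ∩ coordSlab e j α β ∈ (shiftInvariantMeasure e).sets := by
  intro ε hε
  obtain ⟨B, hB, C, hC, hBA, hAC, h⟩ := hA ε hε
  have hB' := inter_coordSlab_mem_generatedRing e j α β hB
  have hC' := inter_coordSlab_mem_generatedRing e j α β hC
  refine ⟨_, hB', _, hC', inter_subset_inter_left _ hBA, inter_subset_inter_left _ hAC, ?_⟩
  refine ((blockMeasure e).m_mono ((blockMeasure e).isSetRing.sdiff_mem hC' hB')
    ((blockMeasure e).isSetRing.sdiff_mem hC hB) ?_).trans_lt h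
  intro x
  simp only [mem_inter_iff, Set.mem_sdiff]
  tauto

theorem inter_biInter_coordSlab_mem (e : HilbertBasis ℕ ℝ E) (α β : ℕ → ℝ) (s : Finset ℕ)
    {A : Set E} (hA : A ∈ (shiftInvariantMeasure e).sets) :
    A ∩ ⋂ j ∈ s, coordSlab e j (α j) (β j) ∈ (shiftInvariantMeasure e).sets := by
  classical
  induction s using Finset.induction_on with
  | empty => simpa using hA
  | insert j s _ ih =>
    rw [Finset.set_biInter_insert, inter_left_comm, inter_comm]
    exact inter_coordSlab_mem e j _ _ ih

/-- The vector obtained by rounding the first `m` coordinates down to multiples of `1 / (m + 1)`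
and replacing the others by zero. -/
def coordSample (e : HilbertBasis ℕ ℝ E) (m : ℕ) (x : E) : E :=
  ∑ k ∈ Finset.range m, ((⌊(m + 1) * inner ℝ (e k) x⌋ : ℝ) / (m + 1)) • e k

theorem inner_coordSample (e : HilbertBasis ℕ ℝ E) (m j : ℕ) (x : E) :
    inner ℝ (e j) (coordSample e m x) =
      if j < m then (⌊(m + 1) * inner ℝ (e j) x⌋ : ℝ) / (m + 1) else 0 :=
  inner_sum_smul_basis e (fun k => (⌊(m + 1) * inner ℝ (e k) x⌋ : ℝ) / (m + 1)) m j

theorem abs_coordSample_sub_le (e : HilbertBasis ℕ ℝ E) {C : ℝ} {x : E} (hx : x ∈ coordBox e C)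
    (m j : ℕ) : |inner ℝ (e j) (coordSample e m x) - inner ℝ (e j) x| ≤
      if j < m then 1 / ((m : ℝ) + 1) else C := by
  rw [inner_coordSample]
  split_ifs with h
  · have hm : (0 : ℝ) < m + 1 := by positivity
    set t := inner ℝ (e j) x
    have h1 := Int.floor_le (((m : ℝ) + 1) * t)
    have h2 := Int.lt_floor_add_one (((m : ℝ) + 1) * t)
    have e1 : (⌊((m : ℝ) + 1) * t⌋ : ℝ) / (m + 1) - t =
        (⌊((m : ℝ) + 1) * t⌋ - ((m : ℝ) + 1) * t) / (m + 1) := by field_simp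
    rw [e1, abs_div, abs_of_pos hm]
    gcongr
    rw [abs_le]
    constructor <;> linarith
  · simpa using hx j

/-- A measurable set has bounded coordinates, so the first `m` floors range over a finite box of
integers. A level set is cut out by `m` slabs of width `1 / (m + 1)`. -/
theorem isSampling_coordSample (e : HilbertBasis ℕ ℝ E) (m : ℕ) :
    (shiftInvariantMeasure e).IsSampling (coordSample e m) where
  finite_image A hA := by
    obtain ⟨C, hC⟩ := exists_subset_coordBox e hA
    set G : (Fin m → ℤ) → E := fun c => ∑ k : Fin m, ((c k : ℝ) / (m + 1)) • e k
    refine ((Set.finite_Icc (fun _ : Fin m => ⌊-((m + 1) * C)⌋)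
      (fun _ => ⌊((m : ℝ) + 1) * C⌋)).image G).subset ?_
    rintro _ ⟨x, hx, rfl⟩
    refine ⟨fun k => ⌊((m : ℝ) + 1) * inner ℝ (e k) x⌋, ⟨fun k => ?_, fun k => ?_⟩, ?_⟩
    · have := (abs_le.1 (hC hx k)).1
      refine Int.floor_le_floor ?_
      have hm : (0 : ℝ) < m + 1 := by positivity
      nlinarith
    · have := (abs_le.1 (hC hx k)).2
      refine Int.floor_le_floor ?_
      gcongr
    · exact Fin.sum_univ_eq_sum_range
        (fun k => ((⌊((m : ℝ) + 1) * inner ℝ (e k) x⌋ : ℝ) / (m + 1)) • e k) m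
  inter_mem y A hA := by
    rcases (A ∩ coordSample e m ⁻¹' {y}).eq_empty_or_nonempty with h0 | ⟨x₀, -, hx₀⟩
    · rw [h0]
      exact (shiftInvariantMeasure e).isSetRing.empty_mem
    have hm : (0 : ℝ) < m + 1 := by positivity
    have hx₀' : coordSample e m x₀ = y := hx₀
    set c : ℕ → ℤ := fun j => ⌊((m : ℝ) + 1) * inner ℝ (e j) x₀⌋ with hc
    -- The floor of `(m + 1) t` equals `c` exactly when `t` lies in `[c / (m + 1), (c + 1) / (m +
    -- 1))`; half-open slabs match this without boundary corrections.
    convert inter_biInter_coordSlab_mem e (fun j => c j / (m + 1))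
      (fun j => (c j + 1) / (m + 1)) (Finset.range m) hA using 2
    ext x
    have h1 : x ∈ coordSample e m ⁻¹' {y} ↔
        ∀ j < m, ⌊((m : ℝ) + 1) * inner ℝ (e j) x⌋ = c j := by
      rw [mem_preimage, mem_singleton_iff, ← hx₀']
      refine ⟨fun h j hj => ?_, fun h => Finset.sum_congr rfl fun k hk => ?_⟩
      · have := congrArg (inner ℝ (e j)) h
        rw [inner_coordSample, inner_coordSample, if_pos hj, if_pos hj,
          div_left_inj' hm.ne'] at this
        exact Int.cast_injective (α := ℝ) this
      · rw [h k (Finset.mem_range.1 hk)]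
    rw [h1]
    simp only [mem_iInter, Finset.mem_range]
    refine forall₂_congr fun j _ => ?_
    rw [Int.floor_eq_iff]
    simp only [coordSlab, Set.mem_ofPred_eq, mem_Ico, div_le_iff₀ hm, lt_div_iff₀ hm]
    rw [mul_comm (inner ℝ (e j) x)]

end Sampling

/-! ### Multiplication operators by admissible functions and their averages. -/

section Multiplication

variable {E : Type*} [NormedAddCommGroup E] [InnerProductSpace ℝ E]

/-- The functions `φ` with `|φ| ≤ 1` which are approximated, uniformly on the sets of bounded
coordinates, by their values at the sample points. -/
structure IsAdmissible (e : HilbertBasis ℕ ℝ E) (φ : E → ℂ) : Prop where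
  norm_le : ∀ x, ‖φ x‖ ≤ 1
  tendsto : ∀ C, TendstoUniformlyOn (fun m x => φ (coordSample e m x)) φ atTop (coordBox e C)

variable {e : HilbertBasis ℕ ℝ E}

/-- The simple function `f · (φ ∘ r_m)`, where `r_m` rounds the coordinates. -/
def sampleMul (e : HilbertBasis ℕ ℝ E) (m : ℕ) (φ : E → ℂ) :
    (shiftInvariantMeasure e).Simple →ₗ[ℂ] (shiftInvariantMeasure e).Simple :=
  (isSampling_coordSample e m).mul φ

theorem sampleMul_toFun (m : ℕ) (φ : E → ℂ) (f : (shiftInvariantMeasure e).Simple) (x : E) :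
    (sampleMul e m φ f).toFun x = φ (coordSample e m x) * f.toFun x := rfl

/-- The extension of `sampleMul` to a contraction. -/
def sampleMulL (m : ℕ) {φ : E → ℂ} (hφ : IsAdmissible e φ) :
    SquareIntegrable e →L[ℂ] SquareIntegrable e :=
  (isSampling_coordSample e m).mulL φ hφ.norm_le

theorem sampleMulL_coe (m : ℕ) {φ : E → ℂ} (hφ : IsAdmissible e φ)
    (f : (shiftInvariantMeasure e).Simple) :
    sampleMulL m hφ (f : SquareIntegrable e) = (sampleMul e m φ f : SquareIntegrable e) :=
  (isSampling_coordSample e m).mulL_coe φ hφ.norm_le f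

theorem norm_sampleMulL_le (m : ℕ) {φ : E → ℂ} (hφ : IsAdmissible e φ) (f : SquareIntegrable e) :
    ‖sampleMulL m hφ f‖ ≤ ‖f‖ :=
  (isSampling_coordSample e m).norm_mulL_le φ hφ.norm_le f

theorem dense_range_coe_simple (e : HilbertBasis ℕ ℝ E) :
    Dense (range ((↑) : (shiftInvariantMeasure e).Simple → SquareIntegrable e)) :=
  UniformSpace.Completion.denseRange_coe

theorem exists_support_subset_coordBox (f : (shiftInvariantMeasure e).Simple) :
    ∃ C, Function.support f.toFun ⊆ coordBox e C :=
  exists_subset_coordBox e f.support_mem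

/-- Monotonicity of the seminorm turns a uniform bound on the support of `f` into an operator
estimate. Two functions and two sampling levels are allowed, to serve both the construction of
`mulOp` and its continuity. -/
theorem norm_sampleMulL_sub_le {φ ψ : E → ℂ} (hφ : IsAdmissible e φ) (hψ : IsAdmissible e ψ)
    {m n : ℕ} {f : (shiftInvariantMeasure e).Simple} {ε : ℝ} (hε : 0 ≤ ε)
    (h : ∀ x ∈ Function.support f.toFun,
      ‖φ (coordSample e m x) - ψ (coordSample e n x)‖ ≤ ε) :
    ‖sampleMulL m hφ (f : SquareIntegrable e) - sampleMulL n hψ (f : SquareIntegrable e)‖ ≤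
      ε * ‖(f : SquareIntegrable e)‖ := by
  rw [sampleMulL_coe, sampleMulL_coe, ← UniformSpace.Completion.coe_sub,
    UniformSpace.Completion.norm_coe, UniformSpace.Completion.norm_coe]
  refine FinAddMeasure.Simple.norm_le_mul_of_le hε fun x => ?_
  have e1 : (sampleMul e m φ f - sampleMul e n ψ f).toFun x =
      (φ (coordSample e m x) - ψ (coordSample e n x)) * f.toFun x := (sub_mul _ _ _).symm
  rw [e1, norm_mul]
  by_cases hx : f.toFun x = 0
  · simp [hx]
  · exact mul_le_mul_of_nonneg_right (h x hx) (norm_nonneg _)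

theorem cauchySeq_sampleMulL {φ : E → ℂ} (hφ : IsAdmissible e φ)
    (f : (shiftInvariantMeasure e).Simple) :
    CauchySeq fun m => sampleMulL m hφ (f : SquareIntegrable e) := by
  obtain ⟨C, hC⟩ := exists_support_subset_coordBox f
  have hu := (hφ.tendsto C).uniformCauchySeqOn
  rw [Metric.uniformCauchySeqOn_iff] at hu
  rw [Metric.cauchySeq_iff]
  intro ε hε
  -- The summand 1 keeps `K` positive when `f` has zero seminorm.
  set K := ‖(f : SquareIntegrable e)‖ + 1 with hK
  have hK0 : 0 < K := by positivity
  obtain ⟨N, hN⟩ := hu (ε / K) (by positivity)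
  refine ⟨N, fun m hm n hn => ?_⟩
  rw [dist_eq_norm]
  refine (norm_sampleMulL_sub_le hφ hφ (by positivity) fun x hx => ?_).trans_lt
    (show ε / K * ‖(f : SquareIntegrable e)‖ < ε from ?_)
  · rw [← dist_eq_norm]
    exact (hN m hm n hn x (hC hx)).le
  · rw [div_mul_eq_mul_div, div_lt_iff₀ hK0]
    exact mul_lt_mul_of_pos_left (by simp [hK]) hε

/-- The operator of multiplication by an admissible function. -/
def mulOp {φ : E → ℂ} (hφ : IsAdmissible e φ) : SquareIntegrable e →L[ℂ] SquareIntegrable e :=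
  (exists_strongLimit (fun m => norm_sampleMulL_le m hφ) (dense_range_coe_simple e)
    (by rintro _ ⟨f, rfl⟩; exact cauchySeq_sampleMulL hφ f)).choose

theorem strongLimit_sampleMulL {φ : E → ℂ} (hφ : IsAdmissible e φ) :
    StrongLimit (fun m => sampleMulL m hφ) (mulOp hφ) :=
  (exists_strongLimit (fun m => norm_sampleMulL_le m hφ) (dense_range_coe_simple e)
    (by rintro _ ⟨f, rfl⟩; exact cauchySeq_sampleMulL hφ f)).choose_spec.1

theorem norm_mulOp_le {φ : E → ℂ} (hφ : IsAdmissible e φ) (f : SquareIntegrable e) :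
    ‖mulOp hφ f‖ ≤ ‖f‖ :=
  (exists_strongLimit (fun m => norm_sampleMulL_le m hφ) (dense_range_coe_simple e)
    (by rintro _ ⟨f, rfl⟩; exact cauchySeq_sampleMulL hφ f)).choose_spec.2 f

theorem isMultiplication_mulOp {φ : E → ℂ} (hφ : IsAdmissible e φ) :
    IsMultiplication e φ (mulOp hφ) := by
  intro A hA
  refine ⟨fun n => sampleMul e n φ (FinAddMeasure.Simple.ind A hA), fun n x hx => ?_, ?_, ?_⟩
  · rw [sampleMul_toFun]
    simp [FinAddMeasure.Simple.ind, FinAddMeasure.Simple.toFun, hx]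
  · obtain ⟨C, hC⟩ := exists_subset_coordBox e hA
    have h := (hφ.tendsto C).mono hC
    rw [Metric.tendstoUniformlyOn_iff] at h
    rw [Metric.tendstoUniformly_iff]
    intro ε hε
    filter_upwards [h ε hε] with n hn x
    rw [sampleMul_toFun]
    by_cases hx : x ∈ A
    · simpa [FinAddMeasure.Simple.ind, FinAddMeasure.Simple.toFun, hx] using hn x hx
    · simpa [FinAddMeasure.Simple.ind, FinAddMeasure.Simple.toFun, hx] using hε
  · have := strongLimit_sampleMulL hφ (FinAddMeasure.Simple.ind A hA : SquareIntegrable e)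
    simpa only [sampleMulL_coe] using this

/-- Multiplication operators converge strongly if the functions converge uniformly on the sets of
bounded coordinates. -/
theorem strongLimit_mulOp {φ : ℕ → E → ℂ} {ψ : E → ℂ} (hφ : ∀ n, IsAdmissible e (φ n))
    (hψ : IsAdmissible e ψ) (h : ∀ C, TendstoUniformlyOn φ ψ atTop (coordBox e C)) :
    StrongLimit (fun n => mulOp (hφ n)) (mulOp hψ) := by
  refine strongLimit_of_dense (fun n => norm_mulOp_le (hφ n)) (norm_mulOp_le hψ)
    (dense_range_coe_simple e) ?_
  rintro _ ⟨f, rfl⟩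
  obtain ⟨C, hC⟩ := exists_support_subset_coordBox f
  rw [Metric.tendsto_atTop]
  intro ε hε
  set K := ‖(f : SquareIntegrable e)‖ + 1 with hK
  have hK0 : 0 < K := by positivity
  -- One third each for sampling `φ n`, for the distance of `φ n` from `ψ`, and for sampling `ψ`.
  set δ := ε / K / 3 with hδ
  have hδ0 : 0 < δ := by positivity
  obtain ⟨N, hN⟩ := eventually_atTop.1 (Metric.tendstoUniformlyOn_iff.1 (h C) δ hδ0)
  refine ⟨N, fun n hn => ?_⟩
  have hlim := ((strongLimit_sampleMulL (hφ n) (f : SquareIntegrable e)).sub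
    (strongLimit_sampleMulL hψ (f : SquareIntegrable e))).norm
  have hle : ‖mulOp (hφ n) (f : SquareIntegrable e) - mulOp hψ (f : SquareIntegrable e)‖ ≤
      ε / K * ‖(f : SquareIntegrable e)‖ := by
    -- Here `n` is fixed and the sampling level `m` tends to infinity, so the sampling of `φ n` need
    -- not be uniform in `n`.
    refine le_of_tendsto hlim ?_
    filter_upwards [Metric.tendstoUniformlyOn_iff.1 ((hφ n).tendsto C) δ hδ0,
      Metric.tendstoUniformlyOn_iff.1 (hψ.tendsto C) δ hδ0] with m h1 h2
    refine norm_sampleMulL_sub_le (hφ n) hψ (by positivity) fun x hx => ?_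
    have h1 := h1 x (hC hx)
    have h2 := h2 x (hC hx)
    have h3 := hN n hn x (hC hx)
    rw [dist_comm] at h1 h3
    have := dist_triangle4 (φ n (coordSample e m x)) (φ n x) (ψ x) (ψ (coordSample e m x))
    rw [dist_eq_norm (φ n (coordSample e m x))] at this
    linarith
  rw [dist_eq_norm]
  refine hle.trans_lt ?_
  rw [div_mul_eq_mul_div, div_lt_iff₀ hK0]
  exact mul_lt_mul_of_pos_left (by simp [hK]) hε

/-- For large `m` the sampled values differ from `φ` by less than `c / 2` on the support, so their
modulus is at least `c / 2` there. The loss of the factor 2 is harmless, as the bound serves only to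
show that an operator is not zero. -/
theorem le_norm_mulOp {φ : E → ℂ} (hφ : IsAdmissible e φ) {f : (shiftInvariantMeasure e).Simple}
    {c : ℝ} (hc : 0 < c) (h : ∀ x ∈ Function.support f.toFun, c ≤ ‖φ x‖) :
    c / 2 * ‖(f : SquareIntegrable e)‖ ≤ ‖mulOp hφ (f : SquareIntegrable e)‖ := by
  obtain ⟨C, hC⟩ := exists_support_subset_coordBox f
  refine ge_of_tendsto (strongLimit_sampleMulL hφ (f : SquareIntegrable e)).norm ?_
  filter_upwards [Metric.tendstoUniformlyOn_iff.1 (hφ.tendsto C) (c / 2) (by positivity)] with m hm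
  rw [sampleMulL_coe, UniformSpace.Completion.norm_coe, UniformSpace.Completion.norm_coe,
    ← le_div_iff₀' (by positivity), div_eq_inv_mul]
  refine FinAddMeasure.Simple.norm_le_mul_of_le (by positivity) fun x => ?_
  rw [sampleMul_toFun, norm_mul]
  by_cases hx : f.toFun x = 0
  · simp [hx]
  have h1 := hm x (hC hx)
  have h2 := h x hx
  rw [dist_eq_norm] at h1
  have h3 : c / 2 ≤ ‖φ (coordSample e m x)‖ := by
    have := norm_sub_norm_le (φ x) (φ (coordSample e m x))
    linarith
  rw [← mul_assoc]
  refine le_mul_of_one_le_left (norm_nonneg _) ?_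
  rw [← div_eq_inv_mul, one_le_div (by positivity)]
  exact h3

/-- The average of a measurable family of multiplication operators is the multiplication by the
average of the functions. -/
theorem isPettisAverage_mulOp [MeasurableSpace E] (ν : Measure E) [IsProbabilityMeasure ν]
    {T : E → SquareIntegrable e →L[ℂ] SquareIntegrable e} {φ : E → E → ℂ} {ψ : E → ℂ}
    (hT : ∀ h f, ‖T h f‖ ≤ ‖f‖) (hφ : ∀ᵐ h ∂ν, ∃ hh : IsAdmissible e (φ h), T h = mulOp hh)
    (hm : ∀ x, AEStronglyMeasurable (fun h => φ h x) ν) (hψ : IsAdmissible e ψ)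
    (hint : ∀ x, ψ x = ∫ h, φ h x ∂ν) : IsPettisAverage T ν (mulOp hψ) := by
  refine isPettisAverage_of_dense hT (dense_range_coe_simple e) ?_
  rintro _ ⟨f, rfl⟩ _ ⟨g, rfl⟩
  have hφi : ∀ x, Integrable (fun h => φ h x) ν := fun x =>
    Integrable.mono' (integrable_const 1) (hm x) (by
      filter_upwards [hφ] with h hh
      exact hh.1.norm_le x)
  -- The sample points `s` and the weights `w` are chosen before `χ`, so the same finite sum serves
  -- for every `φ h` and for `ψ`.
  have hsum : ∀ m, ∃ (s : Finset E) (w : E → ℂ), ∀ χ : E → ℂ, inner ℂ (g : SquareIntegrable e)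
      (sampleMul e m χ f : SquareIntegrable e) = ∑ y ∈ s, χ y * w y := fun m =>
    ⟨_, _, fun χ => by
      rw [UniformSpace.Completion.inner_coe]
      exact (isSampling_coordSample e m).inner_mul χ f g⟩
  choose s w hsum using hsum
  set F : ℕ → E → ℂ := fun m h =>
    inner ℂ (g : SquareIntegrable e) (sampleMul e m (φ h) f : SquareIntegrable e) with hF
  have hFi : ∀ m, Integrable (F m) ν := by
    intro m
    simp only [hF, hsum]
    exact integrable_finsetSum _ fun y _ => (hφi y).mul_const _
  have hFint : ∀ m, ∫ h, F m h ∂ν =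
      inner ℂ (g : SquareIntegrable e) (sampleMul e m ψ f : SquareIntegrable e) := by
    intro m
    simp only [hF, hsum]
    rw [integral_finsetSum _ fun y _ => (hφi y).mul_const _]
    refine Finset.sum_congr rfl fun y _ => ?_
    rw [integral_mul_const, hint]
  have hlim : ∀ᵐ h ∂ν, Tendsto (fun m => F m h) atTop
      (𝓝 (inner ℂ (g : SquareIntegrable e) (T h (f : SquareIntegrable e)))) := by
    filter_upwards [hφ] with h ⟨hh, hTh⟩
    have := (strongLimit_sampleMulL hh (f : SquareIntegrable e))
    simp only [sampleMulL_coe] at this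
    rw [hTh]
    exact tendsto_const_nhds.inner this
  set K := ‖(g : SquareIntegrable e)‖ * ‖(f : SquareIntegrable e)‖
  have hbd : ∀ m, ∀ᵐ h ∂ν, ‖F m h‖ ≤ K := by
    intro m
    filter_upwards [hφ] with h ⟨hh, _⟩
    refine (norm_inner_le_norm _ _).trans (mul_le_mul_of_nonneg_left ?_ (norm_nonneg _))
    rw [← sampleMulL_coe m hh]
    exact norm_sampleMulL_le m hh _
  refine ⟨Integrable.mono' (integrable_const K)
    (aestronglyMeasurable_of_tendsto_ae atTop (fun m => (hFi m).aestronglyMeasurable) hlim)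
    ?_, ?_⟩
  · refine Eventually.of_forall fun h => (norm_inner_le_norm _ _).trans ?_
    exact mul_le_mul_of_nonneg_left (hT _ _) (norm_nonneg _)
  -- At each sampling level the averaging identity is an exchange of an integral with a finite sum;
  -- dominated convergence removes the sampling on both sides.
  · have h1 := tendsto_integral_of_dominated_convergence (fun _ => K)
      (fun m => (hFi m).aestronglyMeasurable) (integrable_const _) hbd hlim
    simp only [hFint] at h1
    have h2 := strongLimit_sampleMulL hψ (f : SquareIntegrable e)
    simp only [sampleMulL_coe] at h2
    exact tendsto_nhds_unique (tendsto_const_nhds.inner h2) h1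

end Multiplication

/-! ### Estimates for weighted series and exponentials. -/

section Weights

/-- Dominated convergence for series. It supplies all the rates below: `w` is the sequence of
frequencies or eigenvalues, and `ε` the coordinate error of sampling or truncation, bounded and
tending to zero coordinatewise but not uniformly. -/
theorem tendsto_tsum_abs_mul_zero {w : ℕ → ℝ} (hw : Summable fun k => |w k|) {ε : ℕ → ℕ → ℝ}
    {B : ℝ} (hB : ∀ m k, |ε m k| ≤ B) (hε : ∀ k, Tendsto (fun m => ε m k) atTop (𝓝 0)) :
    Tendsto (fun m => ∑' k, |w k| * ε m k) atTop (𝓝 0) := by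
  have := tendsto_tsum_of_dominated_convergence (f := fun m k => |w k| * ε m k) (g := fun _ => 0)
    (hw.mul_right B) (fun k => by simpa using (hε k).const_mul |w k|)
    (Eventually.of_forall fun m k => by
      rw [norm_mul, Real.norm_eq_abs, abs_abs]
      exact mul_le_mul_of_nonneg_left (hB m k) (abs_nonneg _))
  simpa using this

theorem abs_tsum_sub_tsum_le {f g w ε : ℕ → ℝ} (hf : Summable f) (hg : Summable g)
    (hw : Summable fun k => |w k|) {B : ℝ} (hB : ∀ k, |ε k| ≤ B)
    (h : ∀ k, |f k - g k| ≤ |w k| * ε k) : |∑' k, f k - ∑' k, g k| ≤ ∑' k, |w k| * ε k := by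
  have hs : Summable fun k => |w k| * ε k := by
    refine Summable.of_norm_bounded (hw.mul_right B) fun k => ?_
    rw [norm_mul, Real.norm_eq_abs, abs_abs]
    exact mul_le_mul_of_nonneg_left (hB k) (abs_nonneg _)
  rw [← hf.tsum_sub hg, ← Real.norm_eq_abs]
  exact tsum_of_norm_bounded hs.hasSum h

theorem tendstoUniformlyOn_of_norm_sub_le {α G : Type*} [SeminormedAddCommGroup G] {F : ℕ → α → G}
    {f : α → G} {s : Set α} {η : ℕ → ℝ} (hη : Tendsto η atTop (𝓝 0))
    (h : ∀ m, ∀ x ∈ s, ‖F m x - f x‖ ≤ η m) : TendstoUniformlyOn F f atTop s := by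
  rw [Metric.tendstoUniformlyOn_iff]
  intro ε hε
  filter_upwards [hη.eventually_lt_const hε] with m hm x hx
  rw [dist_comm, dist_eq_norm]
  exact (h m x hx).trans_lt hm

theorem norm_exp_I_mul_sub_le (a b : ℝ) :
    ‖Complex.exp (Complex.I * a) - Complex.exp (Complex.I * b)‖ ≤ |a - b| := by
  have h : Complex.exp (Complex.I * a) - Complex.exp (Complex.I * b) =
      Complex.exp (Complex.I * b) * (Complex.exp (Complex.I * ((a - b : ℝ) : ℂ)) - 1) := by
    rw [mul_sub, ← Complex.exp_add, mul_one]
    congr 2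
    push_cast
    ring
  rw [h, norm_mul, mul_comm Complex.I (b : ℂ), Complex.norm_exp_ofReal_mul_I, one_mul]
  exact Real.norm_exp_I_mul_ofReal_sub_one_le

theorem abs_exp_sub_exp_le_of_nonpos {a b : ℝ} (ha : a ≤ 0) (hb : b ≤ 0) :
    |Real.exp a - Real.exp b| ≤ |a - b| := by
  have key : ∀ {a b : ℝ}, b ≤ 0 → a ≤ b → |Real.exp a - Real.exp b| ≤ |a - b| := by
    intro a b hb hab
    rw [abs_sub_comm, abs_sub_comm a, abs_of_nonneg (sub_nonneg.2 (Real.exp_le_exp.2 hab)),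
      abs_of_nonneg (sub_nonneg.2 hab)]
    have h1 := Real.add_one_le_exp (a - b)
    have h2 : Real.exp a = Real.exp b * Real.exp (a - b) := by
      rw [← Real.exp_add]; congr 1; ring
    have h3 := Real.exp_pos b
    have h4 := Real.exp_le_one_iff.2 hb
    nlinarith
  rcases le_total a b with h | h
  · exact key hb h
  · rw [abs_sub_comm, abs_sub_comm a]
    exact key ha h

end Weights

/-! ### Characters, Gaussian weights and diagonal operators. -/

section Momentum

variable {E : Type*} [NormedAddCommGroup E] [InnerProductSpace ℝ E] {e : HilbertBasis ℕ ℝ E}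

/-- The rate of the approximation of the `k`-th coordinate by the `m`-th sampling. -/
def sampleError (C : ℝ) (m k : ℕ) : ℝ := if k < m then 1 / ((m : ℝ) + 1) else |C|

theorem sampleError_nonneg (C : ℝ) (m k : ℕ) : 0 ≤ sampleError C m k := by
  unfold sampleError
  split_ifs <;> positivity

theorem abs_sampleError_le (C : ℝ) (m k : ℕ) : |sampleError C m k| ≤ 1 + |C| := by
  rw [abs_of_nonneg (sampleError_nonneg C m k)]
  unfold sampleError
  split_ifs
  · have h1 : 1 / ((m : ℝ) + 1) ≤ 1 := by
      rw [div_le_one (by positivity)]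
      linarith [(Nat.cast_nonneg m : (0 : ℝ) ≤ m)]
    linarith [abs_nonneg C]
  · linarith

theorem tendsto_sampleError (C : ℝ) (k : ℕ) :
    Tendsto (fun m => sampleError C m k) atTop (𝓝 0) := by
  refine tendsto_one_div_add_atTop_nhds_zero_nat.congr' ?_
  filter_upwards [eventually_gt_atTop k] with m hm
  simp [sampleError, hm]

theorem abs_coordSample_sub_le_sampleError {C : ℝ} {x : E} (hx : x ∈ coordBox e C) (m j : ℕ) :
    |inner ℝ (e j) (coordSample e m x) - inner ℝ (e j) x| ≤ sampleError C m j := by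
  refine (abs_coordSample_sub_le e hx m j).trans ?_
  unfold sampleError
  split_ifs
  · exact le_rfl
  · exact le_abs_self C

theorem hasSum_inner_coord (e : HilbertBasis ℕ ℝ E) (h x : E) :
    HasSum (fun k => inner ℝ (e k) h * inner ℝ (e k) x) (inner ℝ h x) := by
  simpa only [real_inner_comm h] using e.hasSum_inner_mul_inner h x

/-- This is the pairing of $\ell_1$ with $\ell_\infty$: only coordinatewise control of `x - y` is
available, so `h` must have absolutely summable coordinates. -/
theorem abs_inner_sub_inner_le {h x y : E} (hh : h ∈ L1coord e) {ε : ℕ → ℝ} {B : ℝ}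
    (hB : ∀ k, |ε k| ≤ B) (hε : ∀ k, |inner ℝ (e k) x - inner ℝ (e k) y| ≤ ε k) :
    |inner ℝ h x - inner ℝ h y| ≤ ∑' k, |inner ℝ (e k) h| * ε k := by
  rw [← (hasSum_inner_coord e h x).tsum_eq, ← (hasSum_inner_coord e h y).tsum_eq]
  refine abs_tsum_sub_tsum_le (hasSum_inner_coord e h x).summable
    (hasSum_inner_coord e h y).summable hh hB fun k => ?_
  rw [← mul_sub, abs_mul]
  exact mul_le_mul_of_nonneg_left (hε k) (abs_nonneg _)

/-- The character `x ↦ exp (i (h, x))`. -/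
def character (h x : E) : ℂ := Complex.exp (Complex.I * (inner ℝ h x : ℝ))

theorem norm_character (h x : E) : ‖character h x‖ = 1 := by
  rw [character, mul_comm, Complex.norm_exp_ofReal_mul_I]

/-- The phase is Lipschitz in `(h, x)`, and the resulting bound on the sampling error involves only
`h`, `m` and `C`, hence is uniform on the box. -/
theorem isAdmissible_character {h : E} (hh : h ∈ L1coord e) : IsAdmissible e (character h) where
  norm_le x := (norm_character h x).le
  tendsto C := by
    refine tendstoUniformlyOn_of_norm_sub_le
      (tendsto_tsum_abs_mul_zero hh (abs_sampleError_le C) (tendsto_sampleError C)) fun m x hx => ?_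
    refine (norm_exp_I_mul_sub_le _ _).trans ?_
    exact abs_inner_sub_inner_le hh (abs_sampleError_le C m)
      (abs_coordSample_sub_le_sampleError hx m)

theorem mem_L1coord_of_eventually_zero {h : E} {n : ℕ} (hh : ∀ k, n ≤ k → inner ℝ (e k) h = 0) :
    h ∈ L1coord e := by
  refine summable_of_ne_finset_zero (s := Finset.range n) fun k hk => ?_
  rw [hh k (by simpa using hk), abs_zero]

theorem coordProj_mem_L1coord (e : HilbertBasis ℕ ℝ E) (n : ℕ) (h : E) :
    coordProj e n h ∈ L1coord e :=
  mem_L1coord_of_eventually_zero (n := n) fun k hk => by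
    rw [inner_coordProj, if_neg (not_lt.2 hk)]

theorem inner_coordProj_comm (e : HilbertBasis ℕ ℝ E) (n : ℕ) (h x : E) :
    inner ℝ (coordProj e n h) x = inner ℝ h (coordProj e n x) := by
  rw [← (hasSum_inner_coord e _ _).tsum_eq, ← (hasSum_inner_coord e _ _).tsum_eq]
  refine tsum_congr fun k => ?_
  rw [inner_coordProj, inner_coordProj]
  split_ifs <;> simp

/-- The error of the truncation of a coordinate bounded by `C`. -/
def truncError (C : ℝ) (n k : ℕ) : ℝ := if k < n then 0 else |C|

theorem abs_truncError_le (C : ℝ) (n k : ℕ) : |truncError C n k| ≤ |C| := by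
  unfold truncError
  split_ifs <;> simp

theorem tendsto_truncError (C : ℝ) (k : ℕ) : Tendsto (fun n => truncError C n k) atTop (𝓝 0) := by
  refine tendsto_const_nhds.congr' ?_
  filter_upwards [eventually_gt_atTop k] with n hn
  simp [truncError, hn]

/-- Replacing `h` by `P_n h` changes the phase on a coordinate box by at most `|C|` times the tail
of $\sum_k |h_k|$. -/
theorem isMomentumShift_mulOp {h : E} (hh : h ∈ L1coord e) :
    IsMomentumShift e h (mulOp (isAdmissible_character hh)) := by
  refine ⟨fun n => mulOp (isAdmissible_character (coordProj_mem_L1coord e n h)),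
    fun n => isMultiplication_mulOp _, strongLimit_mulOp _ _ fun C => ?_⟩
  refine tendstoUniformlyOn_of_norm_sub_le
    (tendsto_tsum_abs_mul_zero hh (abs_truncError_le C) (tendsto_truncError C)) fun n x hx => ?_
  refine (norm_exp_I_mul_sub_le _ _).trans ?_
  rw [inner_coordProj_comm]
  refine abs_inner_sub_inner_le hh (abs_truncError_le C n) fun k => ?_
  rw [inner_coordProj, truncError]
  split_ifs
  · simp
  · simpa using (hx k).trans (le_abs_self C)

/-- The quadratic form with the given coefficients. -/
def coordQuad (e : HilbertBasis ℕ ℝ E) (d : ℕ → ℝ) (x : E) : ℝ := ∑' k, d k * inner ℝ (e k) x ^ 2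

theorem summable_coordQuad {d : ℕ → ℝ} (hd : Summable fun k => |d k|) (x : E) :
    Summable fun k => d k * inner ℝ (e k) x ^ 2 := by
  refine Summable.of_norm_bounded (hd.mul_right (‖x‖ ^ 2)) fun k => ?_
  rw [norm_mul, Real.norm_eq_abs, Real.norm_eq_abs, abs_pow]
  have := abs_coord_le_norm e x k
  gcongr

theorem coordQuad_nonneg {d : ℕ → ℝ} (hd : ∀ k, 0 ≤ d k) (x : E) : 0 ≤ coordQuad e d x :=
  tsum_nonneg fun k => mul_nonneg (hd k) (sq_nonneg _)

/-- The function `x ↦ exp (- (1 / 2) ∑ d_k x_k ^ 2)`. -/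
def gaussianWeight (e : HilbertBasis ℕ ℝ E) (d : ℕ → ℝ) (x : E) : ℂ :=
  (Real.exp (-(1 / 2) * coordQuad e d x) : ℝ)

theorem norm_gaussianWeight (d : ℕ → ℝ) (x : E) :
    ‖gaussianWeight e d x‖ = Real.exp (-(1 / 2) * coordQuad e d x) := by
  rw [gaussianWeight, Complex.norm_real, Real.norm_of_nonneg (Real.exp_pos _).le]

theorem norm_gaussianWeight_sub_le {d d' : ℕ → ℝ} (hd : ∀ k, 0 ≤ d k) (hd' : ∀ k, 0 ≤ d' k)
    (x y : E) : ‖gaussianWeight e d x - gaussianWeight e d' y‖ ≤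
      |coordQuad e d x - coordQuad e d' y| := by
  have h1 := coordQuad_nonneg (e := e) hd x
  have h2 := coordQuad_nonneg (e := e) hd' y
  rw [gaussianWeight, gaussianWeight, ← Complex.ofReal_sub, Complex.norm_real, Real.norm_eq_abs]
  refine (abs_exp_sub_exp_le_of_nonpos (by linarith) (by linarith)).trans ?_
  rw [← mul_sub, abs_mul]
  refine mul_le_of_le_one_left (abs_nonneg _) ?_
  norm_num [abs_le]

theorem isAdmissible_gaussianWeight {d : ℕ → ℝ} (hd : ∀ k, 0 ≤ d k)
    (hs : Summable fun k => |d k|) : IsAdmissible e (gaussianWeight e d) where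
  norm_le x := by
    rw [norm_gaussianWeight, Real.exp_le_one_iff]
    linarith [coordQuad_nonneg (e := e) hd x]
  tendsto C := by
    -- With `u` the sampled and `v` the original coordinate, $u^2 - v^2 = (u+v)(u-v)$ and $|u+v| \le
    -- |u-v| + 2|v| \le B$.
    set B := (1 + |C|) + 2 * |C| with hB
    have hlim := (tendsto_tsum_abs_mul_zero hs (ε := fun m k => sampleError C m k * B)
      (B := (1 + |C|) * B) (fun m k => by
        rw [abs_mul, abs_of_nonneg (by positivity : 0 ≤ B)]
        exact mul_le_mul_of_nonneg_right (abs_sampleError_le C m k) (by positivity))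
      (fun k => by simpa using (tendsto_sampleError C k).mul_const B))
    refine tendstoUniformlyOn_of_norm_sub_le hlim fun m x hx => ?_
    refine (norm_gaussianWeight_sub_le hd hd _ _).trans ?_
    refine abs_tsum_sub_tsum_le (B := (1 + |C|) * B) (summable_coordQuad hs _)
      (summable_coordQuad hs _) hs (fun k => ?_) fun k => ?_
    · rw [abs_mul, abs_of_nonneg (by positivity : 0 ≤ B)]
      exact mul_le_mul_of_nonneg_right (abs_sampleError_le C m k) (by positivity)
    · have h1 := abs_coordSample_sub_le_sampleError hx m k
      have h2 := (le_abs_self _).trans (abs_sampleError_le C m k)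
      have h3 := (hx k).trans (le_abs_self C)
      rw [← mul_sub, abs_mul]
      refine mul_le_mul_of_nonneg_left ?_ (abs_nonneg _)
      rw [sq_sub_sq, abs_mul, mul_comm]
      refine mul_le_mul h1 ?_ (abs_nonneg _) (sampleError_nonneg C m k)
      set u := inner ℝ (e k) (coordSample e m x)
      set v := inner ℝ (e k) x
      have : |u + v| ≤ |u - v| + 2 * |v| := by
        have := abs_add_le (u - v) (2 * v)
        rw [abs_mul, abs_two] at this
        have e1 : u - v + 2 * v = u + v := by ring
        rwa [e1] at this
      linarith

/-- The truncation of a sequence. -/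
def truncate (d : ℕ → ℝ) (n k : ℕ) : ℝ := if k < n then d k else 0

theorem truncate_nonneg {d : ℕ → ℝ} (hd : ∀ k, 0 ≤ d k) (n k : ℕ) : 0 ≤ truncate d n k := by
  unfold truncate
  split_ifs
  exacts [hd k, le_rfl]

theorem summable_abs_truncate (d : ℕ → ℝ) (n : ℕ) : Summable fun k => |truncate d n k| :=
  summable_of_ne_finset_zero (s := Finset.range n) fun k hk => by
    simp only [Finset.mem_range] at hk
    simp [truncate, hk]

/-- On a coordinate box the truncation changes the quadratic form by at most $C^2 \sum_{k \ge n}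
d_k$, a tail of the trace. Summability of the square roots of `d` plays no role. -/
theorem strongLimit_gaussianWeight {d : ℕ → ℝ} (hd : ∀ k, 0 ≤ d k)
    (hs : Summable fun k => |d k|) :
    StrongLimit (fun n => mulOp (isAdmissible_gaussianWeight (e := e) (truncate_nonneg hd n)
      (summable_abs_truncate d n))) (mulOp (isAdmissible_gaussianWeight hd hs)) := by
  refine strongLimit_mulOp _ _ fun C => ?_
  refine tendstoUniformlyOn_of_norm_sub_le (tendsto_tsum_abs_mul_zero hs
    (abs_truncError_le (C ^ 2)) (tendsto_truncError (C ^ 2))) fun n x hx => ?_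
  refine (norm_gaussianWeight_sub_le (truncate_nonneg hd n) hd _ _).trans ?_
  refine abs_tsum_sub_tsum_le (summable_coordQuad (summable_abs_truncate d n) _)
    (summable_coordQuad hs _) hs (abs_truncError_le (C ^ 2) n) fun k => ?_
  rw [← sub_mul, truncate, truncError]
  split_ifs
  · simp
  · rw [zero_sub, abs_mul, abs_neg, abs_pow, abs_pow]
    have := (hx k).trans (le_abs_self C)
    gcongr

/-- The diagonal operator with the given eigenvalues. -/
def diagOp [CompleteSpace E] (e : HilbertBasis ℕ ℝ E) (d : ℕ → ℝ) : E →L[ℝ] E :=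
  ∑' k, d k • (innerSL ℝ (e k)).smulRight (e k)

theorem hasSum_diagOp [CompleteSpace E] {d : ℕ → ℝ} (hd : Summable fun k => |d k|) (x : E) :
    HasSum (fun k => (d k * inner ℝ (e k) x) • e k) (diagOp e d x) := by
  have hs : Summable fun k => d k • (innerSL ℝ (e k)).smulRight (e k) := by
    refine Summable.of_norm_bounded hd fun k => ?_
    rw [norm_smul, ContinuousLinearMap.norm_smulRight_apply, innerSL_apply_norm,
      e.orthonormal.1 k]
    simp
  have := hs.hasSum.mapL (ContinuousLinearMap.apply ℝ E x)
  simpa [mul_smul, diagOp] using this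

theorem inner_diagOp [CompleteSpace E] {d : ℕ → ℝ} (hd : Summable fun k => |d k|) (x : E) (j : ℕ) :
    inner ℝ (e j) (diagOp e d x) = d j * inner ℝ (e j) x := by
  have h := (hasSum_diagOp (e := e) hd x).mapL (innerSL ℝ (e j))
  have h' := hasSum_single (f := fun k => innerSL ℝ (e j) ((d k * inner ℝ (e k) x) • e k)) j
    fun k hk => by simp [inner_basis, hk.symm]
  have := h.unique h'
  simpa [inner_smul_right, e.orthonormal.1 j] using this

theorem inner_diagOp_self [CompleteSpace E] {d : ℕ → ℝ} (hd : Summable fun k => |d k|) (x : E) :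
    inner ℝ (diagOp e d x) x = coordQuad e d x := by
  rw [← (hasSum_inner_coord e _ _).tsum_eq]
  refine tsum_congr fun k => ?_
  rw [inner_diagOp hd]
  ring

theorem isPositive_diagOp [CompleteSpace E] {d : ℕ → ℝ} (hd : Summable fun k => |d k|)
    (h0 : ∀ k, 0 ≤ d k) : (diagOp e d).IsPositive := by
  refine ⟨fun x y => ?_, fun x => ?_⟩
  · change inner ℝ (diagOp e d x) y = inner ℝ x (diagOp e d y)
    rw [← (hasSum_inner_coord e _ _).tsum_eq, ← (hasSum_inner_coord e _ _).tsum_eq]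
    refine tsum_congr fun k => ?_
    rw [inner_diagOp hd, inner_diagOp hd]
    ring
  · have := coordQuad_nonneg (e := e) h0 x
    rw [← inner_diagOp_self hd] at this
    exact this

theorem isNuclear_diagOp [CompleteSpace E] {d : ℕ → ℝ} (hd : Summable fun k => |d k|) :
    IsNuclear (diagOp e d) := by
  refine ⟨fun k => d k • innerSL ℝ (e k), fun k => e k, ?_, fun x => ?_⟩
  · refine hd.congr fun k => ?_
    rw [norm_smul, innerSL_apply_norm, e.orthonormal.1 k]
    simp
  · simpa using hasSum_diagOp hd x

theorem diagOp_apply_basis [CompleteSpace E] {d : ℕ → ℝ} (hd : Summable fun k => |d k|) (k : ℕ) :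
    diagOp e d (e k) = d k • e k :=
  e.ext_coord fun j => by
    rw [inner_diagOp hd, inner_smul_right, inner_basis]
    by_cases h : j = k <;> simp [h]

end Momentum

/-! ### Gaussian measures with independent coordinates, and divergence of their $\ell_1$ sums. -/

section Gaussian

open ProbabilityTheory

/-- The product of countably many standard Gaussian measures. -/
def gaussianProduct : Measure (ℕ → ℝ) := Measure.infinitePi fun _ => gaussianReal 0 1

instance : IsProbabilityMeasure gaussianProduct := by
  unfold gaussianProduct; infer_instance

theorem integral_prod_gaussianProduct {𝕜 : Type*} [RCLike 𝕜] (f : ℕ → ℝ → 𝕜)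
    (hf : ∀ k, Continuous (f k)) (n : ℕ) :
    ∫ ω, ∏ k ∈ Finset.range n, f k (ω k) ∂gaussianProduct =
      ∏ k ∈ Finset.range n, ∫ s, f k s ∂gaussianReal 0 1 := by
  have hind : iIndepFun (fun (k : ℕ) (ω : ℕ → ℝ) => ω k) gaussianProduct :=
    iIndepFun_infinitePi (P := fun _ : ℕ => gaussianReal 0 1) (X := fun _ s => s)
      fun _ => measurable_id
  have hind' := hind.precomp (g := fun i : Fin n => (i : ℕ)) Fin.val_injective
  have h := hind'.integral_fun_prod_comp (f := fun i : Fin n => f i)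
    (fun i => (measurable_pi_apply _).aemeasurable) fun i => (hf i).aestronglyMeasurable
  have hmarg : ∀ k, ∫ ω, f k (ω k) ∂gaussianProduct = ∫ s, f k s ∂gaussianReal 0 1 := by
    intro k
    have hm := Measure.infinitePi_map_eval (fun _ : ℕ => gaussianReal 0 1) k
    rw [← hm, integral_map (measurable_pi_apply k).aemeasurable (hf k).aestronglyMeasurable]
    rfl
  simp only [hmarg] at h
  rw [← Fin.prod_univ_eq_prod_range (fun k => ∫ s, f k s ∂gaussianReal 0 1), ← h]
  refine integral_congr_ae (Eventually.of_forall fun ω => ?_)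
  exact (Fin.prod_univ_eq_prod_range (fun k => f k (ω k)) n).symm

theorem lintegral_sq_gaussianProduct_eq (k : ℕ) :
    ∫⁻ ω, ENNReal.ofReal (ω k ^ 2) ∂gaussianProduct =
      ∫⁻ s, ENNReal.ofReal (s ^ 2) ∂gaussianReal 0 1 := by
  have hm := Measure.infinitePi_map_eval (fun _ : ℕ => gaussianReal 0 1) k
  rw [← hm, lintegral_map (by fun_prop) (measurable_pi_apply k)]
  rfl

/-- The expectation of the series is $\sum_k \sigma_k^2$ times the second moment of a standard
Gaussian, which is finite. -/
theorem ae_summable_sq_gaussianProduct {σ : ℕ → ℝ} (hσ : Summable fun k => σ k ^ 2) :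
    ∀ᵐ ω ∂gaussianProduct, Summable fun k => (σ k * ω k) ^ 2 := by
  set I := ∫⁻ s, ENNReal.ofReal (s ^ 2) ∂gaussianReal 0 1 with hI
  have hIt : I ≠ ⊤ :=
    ((memLp_id_gaussianReal (μ := 0) (v := 1) 2).integrable_sq).lintegral_lt_top.ne
  have hmeas : ∀ k, Measurable fun ω : ℕ → ℝ => ENNReal.ofReal ((σ k * ω k) ^ 2) := fun k => by
    fun_prop
  have hint : ∫⁻ ω, ∑' k, ENNReal.ofReal ((σ k * ω k) ^ 2) ∂gaussianProduct ≠ ⊤ := by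
    rw [lintegral_tsum fun k => (hmeas k).aemeasurable]
    have : ∀ k, ∫⁻ ω, ENNReal.ofReal ((σ k * ω k) ^ 2) ∂gaussianProduct =
        ENNReal.ofReal (σ k ^ 2) * I := by
      intro k
      simp only [mul_pow, ENNReal.ofReal_mul (sq_nonneg (σ k))]
      rw [lintegral_const_mul _ (by fun_prop), lintegral_sq_gaussianProduct_eq]
    simp only [this]
    rw [ENNReal.tsum_mul_right]
    exact ENNReal.mul_ne_top hσ.tsum_ofReal_ne_top hIt
  filter_upwards [ae_lt_top (Measurable.tsum hmeas) hint] with ω hω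
  have := ENNReal.summable_toReal hω.ne
  simpa only [ENNReal.toReal_ofReal (sq_nonneg _)] using this

/-- A uniform bound for the Laplace transform of the absolute value of a shifted Gaussian. -/
theorem exists_integral_exp_neg_abs_le : ∃ p > 0, ∀ σ δ : ℝ, 0 ≤ σ →
    ∫ s, Real.exp (-|σ * s + δ|) ∂gaussianReal 0 1 ≤ Real.exp (-(p * (σ / (1 + σ)))) := by
  have hpos : ∀ A : Set ℝ, volume A ≠ 0 → 0 < (gaussianReal 0 1).real A := by
    intro A hA
    refine ENNReal.toReal_pos (fun h => hA ?_) (measure_ne_top _ _)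
    exact gaussianReal_absolutelyContinuous' 0 one_ne_zero h
  have h1 := hpos (Ici 1) (by simp)
  have h2 := hpos (Iic (-1)) (by simp)
  -- The constant is the smaller of the standard Gaussian masses of `[1, ∞)` and `(-∞, -1]`, both
  -- positive.
  refine ⟨min _ _, lt_min h1 h2, fun σ δ hσ => ?_⟩
  set p := min ((gaussianReal 0 1).real (Ici (1 : ℝ))) ((gaussianReal 0 1).real (Iic (-1 : ℝ)))
  -- On the half-line whose sign agrees with `δ` the shift can only increase `|σ s + δ|`, so this is
  -- at least `σ` there.
  obtain ⟨A, hAm, hA, hpA⟩ : ∃ A : Set ℝ, MeasurableSet A ∧ (∀ s ∈ A, σ ≤ |σ * s + δ|) ∧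
      p ≤ (gaussianReal 0 1).real A := by
    rcases le_total 0 δ with hδ | hδ
    · refine ⟨Ici 1, measurableSet_Ici, fun s hs => ?_, min_le_left _ _⟩
      have : (1 : ℝ) ≤ s := hs
      refine le_trans ?_ (le_abs_self _)
      nlinarith
    · refine ⟨Iic (-1), measurableSet_Iic, fun s hs => ?_, min_le_right _ _⟩
      have : s ≤ (-1 : ℝ) := hs
      refine le_trans ?_ (neg_le_abs _)
      nlinarith
  have hle : ∀ s, Real.exp (-|σ * s + δ|) ≤
      1 - A.indicator (fun _ => 1 - Real.exp (-σ)) s := by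
    intro s
    by_cases hs : s ∈ A
    · have := hA s hs
      simp [hs, this]
    · simp [hs]
  have hi : Integrable (fun s => 1 - A.indicator (fun _ => 1 - Real.exp (-σ)) s)
      (gaussianReal 0 1) :=
    (integrable_const 1).sub ((integrable_const _).indicator hAm)
  have hint := integral_mono_of_nonneg (μ := gaussianReal 0 1)
    (Eventually.of_forall fun s => (Real.exp_pos (-|σ * s + δ|)).le) hi (Eventually.of_forall hle)
  rw [integral_sub (integrable_const 1) ((integrable_const _).indicator hAm),
    integral_indicator_const _ hAm] at hint
  -- This makes `1 - exp (-σ)` at least `σ / (1 + σ)`, a lower bound valid for small and large `σ`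
  -- alike.
  have hexp : Real.exp (-σ) ≤ 1 / (1 + σ) := by
    rw [Real.exp_neg, ← one_div]
    refine one_div_le_one_div_of_le (by linarith) ?_
    linarith [Real.add_one_le_exp σ]
  have hfrac : σ / (1 + σ) = 1 - 1 / (1 + σ) := by
    have : 1 + σ ≠ 0 := by linarith
    field_simp
    ring
  have h0 : 0 ≤ σ / (1 + σ) := by positivity
  have h3 : p * (σ / (1 + σ)) ≤ (gaussianReal 0 1).real A * (1 - Real.exp (-σ)) := by
    refine mul_le_mul hpA ?_ h0 measureReal_nonneg
    rw [hfrac]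
    linarith
  have h4 := Real.add_one_le_exp (-(p * (σ / (1 + σ))))
  simp only [integral_const, probReal_univ, smul_eq_mul, mul_one] at hint
  linarith

/-- By independence the expectation of $\prod_{k<N} \exp(-|\sigma_k\omega_k+\delta_k|)$ is at most
$\exp(-p\sum_{k<N}\sigma_k/(1+\sigma_k))$, which tends to zero. So the infimum of these products
vanishes almost surely, whereas a convergent sum would keep them above a positive constant. -/
theorem ae_not_summable_gaussianProduct {σ : ℕ → ℝ} (hσ0 : ∀ k, 0 ≤ σ k)
    (hσ : ¬ Summable fun k => σ k / (1 + σ k)) (δ : ℕ → ℝ) :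
    ∀ᵐ ω ∂gaussianProduct, ¬ Summable fun k => |σ k * ω k + δ k| := by
  obtain ⟨p, hp, hle⟩ := exists_integral_exp_neg_abs_le
  set G : ℕ → (ℕ → ℝ) → ℝ := fun N ω =>
    ∏ k ∈ Finset.range N, Real.exp (-|σ k * ω k + δ k|) with hG
  have hGc : ∀ N, Continuous (G N) := fun N => by
    simp only [hG]
    fun_prop
  have hG0 : ∀ N ω, 0 ≤ G N ω := fun N ω => Finset.prod_nonneg fun _ _ => (Real.exp_pos _).le
  have hGi : ∀ N, Integrable (G N) gaussianProduct := fun N =>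
    Integrable.mono' (integrable_const 1) (hGc N).aestronglyMeasurable
      (Eventually.of_forall fun ω => by
        rw [Real.norm_of_nonneg (hG0 N ω)]
        exact Finset.prod_le_one (fun _ _ => (Real.exp_pos _).le) fun k _ => by simp)
  have hint : ∀ N, ∫ ω, G N ω ∂gaussianProduct ≤
      Real.exp (-(p * ∑ k ∈ Finset.range N, σ k / (1 + σ k))) := by
    intro N
    rw [hG, integral_prod_gaussianProduct (fun k s => Real.exp (-|σ k * s + δ k|))
      (fun k => by fun_prop), Finset.mul_sum, ← Finset.sum_neg_distrib, Real.exp_sum]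
    exact Finset.prod_le_prod (fun k _ => integral_nonneg fun s => (Real.exp_pos _).le)
      fun k _ => hle _ _ (hσ0 k)
  have hlim : Tendsto (fun N => ENNReal.ofReal (∫ ω, G N ω ∂gaussianProduct)) atTop (𝓝 0) := by
    rw [← ENNReal.ofReal_zero]
    refine (ENNReal.continuous_ofReal.tendsto 0).comp ?_
    refine squeeze_zero (fun N => integral_nonneg (hG0 N)) hint ?_
    refine Real.tendsto_exp_neg_atTop_nhds_zero.comp (Tendsto.const_mul_atTop hp ?_)
    exact (not_summable_iff_tendsto_nat_atTop_of_nonneg fun k =>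
      div_nonneg (hσ0 k) (by linarith [hσ0 k])).1 hσ
  have hm : Measurable fun ω => ⨅ N, ENNReal.ofReal (G N ω) :=
    Measurable.iInf fun N => (hGc N).measurable.ennreal_ofReal
  have hzero : ∫⁻ ω, ⨅ N, ENNReal.ofReal (G N ω) ∂gaussianProduct = 0 := by
    refine le_antisymm (ge_of_tendsto' hlim fun N => ?_) zero_le
    rw [ofReal_integral_eq_lintegral_ofReal (hGi N) (Eventually.of_forall (hG0 N))]
    exact lintegral_mono fun ω => iInf_le _ N
  filter_upwards [(lintegral_eq_zero_iff hm).1 hzero] with ω hω hs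
  have h1 : ENNReal.ofReal (Real.exp (-∑' k, |σ k * ω k + δ k|)) ≤
      ⨅ N, ENNReal.ofReal (G N ω) := by
    refine le_iInf fun N => ENNReal.ofReal_le_ofReal ?_
    rw [hG]
    simp only
    rw [← Real.exp_sum, Finset.sum_neg_distrib]
    refine Real.exp_le_exp.2 (neg_le_neg ?_)
    exact hs.sum_le_tsum _ fun _ _ => abs_nonneg _
  have hω' : ⨅ N, ENNReal.ofReal (G N ω) = 0 := hω
  rw [hω', nonpos_iff_eq_zero, ENNReal.ofReal_eq_zero] at h1
  exact absurd h1 (not_le.2 (Real.exp_pos _))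

variable {E : Type*} [NormedAddCommGroup E] [InnerProductSpace ℝ E]

/-- The random vector with independent Gaussian coordinates. -/
def gaussianVector (e : HilbertBasis ℕ ℝ E) (σ : ℕ → ℝ) (ω : ℕ → ℝ) : E :=
  ∑' k, (σ k * ω k) • e k

/-- The coordinates are almost surely in $\ell_2$. On the exceptional null set `gaussianVector` is
the default value of a divergent series, which the image measure does not see. -/
theorem ae_hasSum_gaussianVector (e : HilbertBasis ℕ ℝ E) {σ : ℕ → ℝ}
    (hσ : Summable fun k => σ k ^ 2) :
    ∀ᵐ ω ∂gaussianProduct, HasSum (fun k => (σ k * ω k) • e k) (gaussianVector e σ ω) ∧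
      ∀ j, inner ℝ (e j) (gaussianVector e σ ω) = σ j * ω j := by
  filter_upwards [ae_summable_sq_gaussianProduct hσ] with ω hω
  have hmem : Memℓp (fun k => σ k * ω k) 2 := memℓp_gen (by
    simpa [mul_pow] using hω)
  have h := e.hasSum_repr_symm ⟨_, hmem⟩
  have heq : gaussianVector e σ ω = e.repr.symm ⟨_, hmem⟩ := h.tsum_eq
  rw [heq]
  refine ⟨h, fun j => ?_⟩
  rw [← e.repr_apply_apply, LinearIsometryEquiv.apply_symm_apply]

variable [MeasurableSpace E] [BorelSpace E]

theorem aemeasurable_gaussianVector (e : HilbertBasis ℕ ℝ E) {σ : ℕ → ℝ}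
    (hσ : Summable fun k => σ k ^ 2) : AEMeasurable (gaussianVector e σ) gaussianProduct := by
  refine aemeasurable_of_tendsto_metrizable_ae atTop
    (f := fun n ω => ∑ k ∈ Finset.range n, (σ k * ω k) • e k) (fun n => ?_) ?_
  · refine Continuous.aemeasurable ?_
    fun_prop
  · filter_upwards [ae_hasSum_gaussianVector e hσ] with ω hω
    exact hω.1.tendsto_sum_nat

/-- Partial sums of the phase give products of one-dimensional Gaussian characteristic functions by
independence; the integrands have modulus one, so dominated convergence passes to the full series.
-/
theorem charFun_map_gaussianVector (e : HilbertBasis ℕ ℝ E) {σ : ℕ → ℝ}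
    (hσ : Summable fun k => σ k ^ 2) (ξ : E) :
    charFun (gaussianProduct.map (gaussianVector e σ)) ξ =
      gaussianWeight e (fun k => σ k ^ 2) ξ := by
  have hs : Summable fun k => σ k ^ 2 * inner ℝ (e k) ξ ^ 2 :=
    summable_coordQuad (by simpa using hσ) ξ
  rw [charFun_apply, integral_map (aemeasurable_gaussianVector e hσ)
    (by fun_prop)]
  set F : ℕ → (ℕ → ℝ) → ℂ := fun n ω => ∏ k ∈ Finset.range n,
    Complex.exp (((inner ℝ (e k) ξ * σ k : ℝ) : ℂ) * (ω k : ℂ) * Complex.I) with hF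
  have hFc : ∀ n, Continuous (F n) := fun n => by
    simp only [hF]
    fun_prop
  have hFn : ∀ n ω, ‖F n ω‖ = 1 := fun n ω => by
    simp only [hF, norm_prod]
    refine Finset.prod_eq_one fun k _ => ?_
    rw [← Complex.ofReal_mul, Complex.norm_exp_ofReal_mul_I]
  have h1 : Tendsto (fun n => ∫ ω, F n ω ∂gaussianProduct) atTop
      (𝓝 (∫ ω, Complex.exp ((inner ℝ (gaussianVector e σ ω) ξ : ℝ) * Complex.I)
        ∂gaussianProduct)) := by
    refine tendsto_integral_of_dominated_convergence (fun _ => 1)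
      (fun n => (hFc n).aestronglyMeasurable) (integrable_const _)
      (fun n => Eventually.of_forall fun ω => (hFn n ω).le) ?_
    filter_upwards [ae_hasSum_gaussianVector e hσ] with ω hω
    have h2 := (hasSum_inner_coord e (gaussianVector e σ ω) ξ).tendsto_sum_nat
    have hc : Continuous fun s : ℝ => Complex.exp (s * Complex.I) := by fun_prop
    have h3 := (hc.tendsto _).comp h2
    refine h3.congr fun n => ?_
    simp only [Function.comp_apply, hF, ← Complex.exp_sum]
    congr 1
    rw [Complex.ofReal_sum, Finset.sum_mul]
    refine Finset.sum_congr rfl fun k _ => ?_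
    rw [hω.2 k]
    push_cast
    ring
  have h4 : ∀ n, ∫ ω, F n ω ∂gaussianProduct =
      ((Real.exp (-(1 / 2) * ∑ k ∈ Finset.range n, σ k ^ 2 * inner ℝ (e k) ξ ^ 2) : ℝ) : ℂ) := by
    intro n
    rw [hF, integral_prod_gaussianProduct (fun k s =>
      Complex.exp (((inner ℝ (e k) ξ * σ k : ℝ) : ℂ) * (s : ℂ) * Complex.I))
      (fun k => by fun_prop), Finset.mul_sum, Real.exp_sum, Complex.ofReal_prod]
    refine Finset.prod_congr rfl fun k _ => ?_
    rw [← charFun_apply_real, charFun_gaussianReal, Complex.ofReal_exp]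
    congr 1
    push_cast
    ring
  simp only [h4] at h1
  refine tendsto_nhds_unique h1 ?_
  exact (Complex.continuous_ofReal.tendsto _).comp ((Real.continuous_exp.tendsto _).comp
    (hs.hasSum.tendsto_sum_nat.const_mul _))

/-- The centered Gaussian measure with a diagonal covariance operator. -/
theorem exists_gaussianMeasure (e : HilbertBasis ℕ ℝ E) {d : ℕ → ℝ} (hd : ∀ k, 0 ≤ d k)
    (hs : Summable fun k => |d k|) : ∃ ν : Measure E, IsProbabilityMeasure ν ∧
      (∀ ξ, charFun ν ξ = gaussianWeight e d ξ) ∧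
      (∀ k, d k = 0 → ∀ᵐ h ∂ν, inner ℝ (e k) h = 0) ∧
      ((¬ Summable fun k => √(d k) / (1 + √(d k))) →
        ∀ δ : ℕ → ℝ, ∀ᵐ h ∂ν, ¬ Summable fun k => |inner ℝ (e k) h + δ k|) := by
  have hsq : ∀ k, √(d k) ^ 2 = d k := fun k => Real.sq_sqrt (hd k)
  have hσ : Summable fun k => √(d k) ^ 2 := by
    simpa only [hsq, abs_of_nonneg (hd _)] using hs
  have hm := aemeasurable_gaussianVector e hσ
  refine ⟨gaussianProduct.map (gaussianVector e fun k => √(d k)),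
    Measure.isProbabilityMeasure_map hm, fun ξ => ?_, fun k hk => ?_, fun hn δ => ?_⟩
  · rw [charFun_map_gaussianVector e hσ]
    simp only [hsq]
  · rw [ae_map_iff hm (measurableSet_eq_fun (by fun_prop) (by fun_prop))]
    filter_upwards [ae_hasSum_gaussianVector e hσ] with ω hω
    rw [hω.2 k, hk, Real.sqrt_zero, zero_mul]
  -- Divergence of a non-negative series is rewritten as an infinite extended sum, which exhibits
  -- the set as measurable and allows a transfer to the image measure.
  · have hset : {h : E | ¬ Summable fun k => |inner ℝ (e k) h + δ k|} =
        {h : E | ∑' k, ENNReal.ofReal |inner ℝ (e k) h + δ k| = ⊤} := by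
      ext h
      refine ⟨fun hh => by_contra fun ht => hh ?_, fun hh hsum => hsum.tsum_ofReal_ne_top hh⟩
      have := ENNReal.summable_toReal ht
      simpa only [ENNReal.toReal_ofReal (abs_nonneg _)] using this
    have hmeas : MeasurableSet {h : E | ¬ Summable fun k => |inner ℝ (e k) h + δ k|} := by
      rw [hset]
      refine measurableSet_eq_fun (Measurable.tsum fun k => ?_) measurable_const
      fun_prop
    rw [ae_map_iff hm hmeas]
    filter_upwards [ae_hasSum_gaussianVector e hσ,
      ae_not_summable_gaussianProduct (fun k => Real.sqrt_nonneg (d k)) hn δ] with ω hω hω'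
    simpa only [hω.2] using hω'

end Gaussian

namespace FinAddMeasure

theorem m_biUnion_eq_zero {X ι : Type*} (μ : FinAddMeasure X) (T : Finset ι) (S : ι → Set X)
    (hS : ∀ i ∈ T, S i ∈ μ.sets) (h0 : ∀ i ∈ T, μ.m (S i) = 0) : μ.m (⋃ i ∈ T, S i) = 0 := by
  classical
  induction T using Finset.induction_on with
  | empty => simpa using μ.m_empty
  | insert a T _ ih =>
    have hT := μ.isSetRing.biUnion_mem T fun i hi => hS i (Finset.mem_insert_of_mem hi)
    have ha := hS a (Finset.mem_insert_self a T)
    have h1 := μ.m_union_le ha hT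
    rw [h0 a (Finset.mem_insert_self a T), ih (fun i hi => hS i (Finset.mem_insert_of_mem hi))
      (fun i hi => h0 i (Finset.mem_insert_of_mem hi)), add_zero] at h1
    rw [Finset.set_biUnion_insert]
    exact le_antisymm h1 (μ.nonneg _ (μ.isSetRing.union_mem ha hT))

end FinAddMeasure

/-! ### Null intersections of shifted blocks and vanishing of the averaged shifts. -/

section Overlap

variable {E : Type*} [NormedAddCommGroup E] [InnerProductSpace ℝ E]

/-- The volume of a set contained in two families of edges vanishes if the distances of the
centers are not summable. -/
theorem blockVolume_inter_eq_zero {a b a' b' : ℕ → ℝ} (h : AbsMeasurableEdges a b)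
    (h' : AbsMeasurableEdges a' b')
    (hI : AbsMeasurableEdges (fun j => max (a j) (a' j)) fun j => min (b j) (b' j))
    (hu : ¬ Summable fun j => |(a j + b j) / 2 - (a' j + b' j) / 2|) :
    blockVolume (fun j => max (a j) (a' j)) (fun j => min (b j) (b' j)) = 0 := by
  set l : ℕ → ℝ := fun j => max 0 (Real.log (b j - a j)) with hl
  set l' : ℕ → ℝ := fun j => max 0 (Real.log (b' j - a' j)) with hl'
  set u : ℕ → ℝ := fun j => (a j + b j) / 2 - (a' j + b' j) / 2 with hudef
  have hls : Summable l := h.summable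
  have hls' : Summable l' := h'.summable
  have hl0 : ∀ j, 0 ≤ l j := fun j => le_max_left _ _
  have hl0' : ∀ j, 0 ≤ l' j := fun j => le_max_left _ _
  set S := ∑' j, l j + ∑' j, l' j with hS
  -- Both edges have length at most $L = e^{l_j + l'_j}$, so the intersection has length at most $L
  -- - |u_j|$. Since $L \le e^S$, this is at most $L(1 - |u_j|e^{-S}) \le L\exp(-|u_j|e^{-S})$.
  have hlen : ∀ j, min (b j) (b' j) - max (a j) (a' j) ≤
      Real.exp (l j + l' j - |u j| * Real.exp (-S)) := by
    intro j
    have h1 : b j - a j ≤ Real.exp (l j + l' j) := by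
      rw [← Real.log_le_iff_le_exp (sub_pos.2 (h.lt j))]
      linarith [le_max_right 0 (Real.log (b j - a j)), hl0' j]
    have h2 : b' j - a' j ≤ Real.exp (l j + l' j) := by
      rw [← Real.log_le_iff_le_exp (sub_pos.2 (h'.lt j))]
      linarith [le_max_right 0 (Real.log (b' j - a' j)), hl0 j]
    have h3 : min (b j) (b' j) - max (a j) (a' j) ≤ Real.exp (l j + l' j) - |u j| := by
      have e1 := min_le_left (b j) (b' j)
      have e2 := min_le_right (b j) (b' j)
      have e3 := le_max_left (a j) (a' j)
      have e4 := le_max_right (a j) (a' j)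
      rw [le_sub_comm, abs_le]
      simp only [hudef]
      constructor <;> linarith
    have h4 : Real.exp (l j + l' j) ≤ Real.exp S := by
      refine Real.exp_le_exp.2 (add_le_add ?_ ?_)
      · exact hls.le_tsum j fun i _ => hl0 i
      · exact hls'.le_tsum j fun i _ => hl0' i
    have h5 := Real.add_one_le_exp (-(|u j| * Real.exp (-S)))
    have h6 := Real.exp_pos (l j + l' j)
    have h7 : Real.exp (l j + l' j) * Real.exp (-S) ≤ 1 := by
      rw [Real.exp_neg, ← div_eq_mul_inv, div_le_one (Real.exp_pos _)]
      exact h4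
    rw [sub_eq_add_neg (l j + l' j), Real.exp_add]
    have h8 := abs_nonneg (u j)
    nlinarith
  -- The positive logarithms contribute at most `S` in total, while divergence of $\sum_j|u_j|$
  -- drives the exponent to $-\infty$.
  have hprod : ∀ N, ∏ j ∈ Finset.range N, (min (b j) (b' j) - max (a j) (a' j)) ≤
      Real.exp (S - Real.exp (-S) * ∑ j ∈ Finset.range N, |u j|) := by
    intro N
    refine (Finset.prod_le_prod (fun j _ => (sub_pos.2 (hI.lt j)).le) fun j _ => hlen j).trans ?_
    rw [← Real.exp_sum, Finset.sum_sub_distrib, Finset.sum_add_distrib, ← Finset.sum_mul,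
      mul_comm (Real.exp (-S))]
    refine Real.exp_le_exp.2 (sub_le_sub_right (add_le_add ?_ ?_) _)
    · exact hls.sum_le_tsum _ fun i _ => hl0 i
    · exact hls'.sum_le_tsum _ fun i _ => hl0' i
  refine tendsto_nhds_unique hI.tendsto (squeeze_zero
    (fun N => Finset.prod_nonneg fun j _ => (sub_pos.2 (hI.lt j)).le) hprod ?_)
  refine Real.tendsto_exp_atBot.comp ?_
  simp only [sub_eq_add_neg]
  refine tendsto_atBot_add_const_left _ _ (tendsto_neg_atTop_atBot.comp ?_)
  exact Tendsto.const_mul_atTop (Real.exp_pos _)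
    ((not_summable_iff_tendsto_nat_atTop_of_nonneg fun j => abs_nonneg _).1 hu)

theorem blockMeasure_inter_eq_zero (e : HilbertBasis ℕ ℝ E) {a b a' b' : ℕ → ℝ}
    (h : AbsMeasurableEdges a b) (h' : AbsMeasurableEdges a' b')
    (hu : ¬ Summable fun j => |(a j + b j) / 2 - (a' j + b' j) / 2|) :
    (blockMeasure e).m (block e a b ∩ block e a' b') = 0 := by
  rcases (block e a b ∩ block e a' b').eq_empty_or_nonempty with h0 | hne
  · rw [h0, FinAddMeasure.m_empty]
  have hI := h.inter h' hne
  rw [block_inter] at hne ⊢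
  rw [(blockMeasure_block e hI hne).2]
  exact blockVolume_inter_eq_zero h h' hI hu

theorem block_mem_blockMeasure_sets (e : HilbertBasis ℕ ℝ E) {a b : ℕ → ℝ}
    (h : AbsMeasurableEdges a b) : block e a b ∈ (blockMeasure e).sets :=
  subset_generatedRing _ (Or.inr ⟨a, b, h, rfl⟩)

theorem coordShift_zero (e : HilbertBasis ℕ ℝ E) (f : SquareIntegrable e) :
    coordShift e 0 f = f := by
  induction f using UniformSpace.Completion.induction_on with
  | hp => exact isClosed_eq (by fun_prop) (by fun_prop)
  | ih f =>
    rw [coordShift, FinAddMeasure.L2comp_coe]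
    exact congrArg _ (FinAddMeasure.Simple.ext fun x => congrArg f.toFun (sub_zero x))

variable [MeasurableSpace E]

/-- Almost every shift of a measurable set meets another measurable set in a null set, if almost
all vectors lie in no translate of `ℓ_1`. -/
theorem ae_shiftInvariantMeasure_inter_eq_zero (e : HilbertBasis ℕ ℝ E) {ν : Measure E}
    (hν : ∀ δ : ℕ → ℝ, ∀ᵐ h ∂ν, ¬ Summable fun k => |inner ℝ (e k) h + δ k|) {A B : Set E}
    (hA : A ∈ (shiftInvariantMeasure e).sets) (hB : B ∈ (shiftInvariantMeasure e).sets) :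
    ∀ᵐ h ∂ν, (shiftInvariantMeasure e).m (B ∩ (fun x => x - h) ⁻¹' A) = 0 := by
  obtain ⟨T, hT, hAT⟩ := exists_block_cover e hA
  obtain ⟨T', hT', hBT⟩ := exists_block_cover e hB
  -- Only finitely many pairs of covering blocks occur, so the exceptional null sets for the
  -- differences of their centers can be united. Shifting by `h` adds the coordinates of `h` to the
  -- first center.
  have hall : ∀ᵐ h ∂ν, ∀ r ∈ T ×ˢ T', ¬ Summable fun k => |inner ℝ (e k) h +
      ((r.1.1 k + r.1.2 k) / 2 - (r.2.1 k + r.2.2 k) / 2)| := by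
    rw [Finset.eventually_all]
    exact fun r _ => hν fun k => (r.1.1 k + r.1.2 k) / 2 - (r.2.1 k + r.2.2 k) / 2
  filter_upwards [hall] with h hh
  set G : ((ℕ → ℝ) × (ℕ → ℝ)) × ((ℕ → ℝ) × (ℕ → ℝ)) → Set E := fun r =>
    block e (fun j => r.1.1 j + inner ℝ (e j) h) (fun j => r.1.2 j + inner ℝ (e j) h) ∩
      block e r.2.1 r.2.2 with hG
  have hedge : ∀ r ∈ T ×ˢ T', AbsMeasurableEdges (fun j => r.1.1 j + inner ℝ (e j) h)
      (fun j => r.1.2 j + inner ℝ (e j) h) ∧ AbsMeasurableEdges r.2.1 r.2.2 := fun r hr =>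
    ⟨(hT _ (Finset.mem_product.1 hr).1).shift (abs_coord_le e h), hT' _ (Finset.mem_product.1 hr).2⟩
  have hGs : ∀ r ∈ T ×ˢ T', G r ∈ (blockMeasure e).sets := fun r hr =>
    (blockMeasure e).isSetRing.inter_mem (block_mem_blockMeasure_sets e (hedge r hr).1)
      (block_mem_blockMeasure_sets e (hedge r hr).2)
  have hG0 : ∀ r ∈ T ×ˢ T', (blockMeasure e).m (G r) = 0 := fun r hr => by
    refine blockMeasure_inter_eq_zero e (hedge r hr).1 (hedge r hr).2 fun hs => hh r hr ?_
    refine hs.congr fun k => ?_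
    congr 1
    ring
  have hsub : B ∩ (fun x => x - h) ⁻¹' A ⊆ ⋃ r ∈ T ×ˢ T', G r := by
    rintro x ⟨hxB, hxA⟩
    obtain ⟨p, hp, hxp⟩ := mem_iUnion₂.1 (hAT hxA)
    obtain ⟨q, hq, hxq⟩ := mem_iUnion₂.1 (hBT hxB)
    refine mem_iUnion₂.2 ⟨(p, q), Finset.mem_product.2 ⟨hp, hq⟩, ?_, hxq⟩
    rw [← preimage_sub_block]
    exact hxp
  have hmem := (blockMeasure e).isSetRing.biUnion_mem (T ×ˢ T') hGs
  -- The completed measure is bounded by that of any larger ring set, here a finite union of null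
  -- intersections of blocks.
  have hle := (blockMeasure e).complM_le hmem hsub
  rw [FinAddMeasure.m_biUnion_eq_zero _ _ _ hGs hG0] at hle
  refine le_antisymm hle ((shiftInvariantMeasure e).nonneg _ ?_)
  exact (shiftInvariantMeasure e).isSetRing.inter_mem hB
    ((shiftInvariantMeasure_preserves e h).mem A hA)

/-- If almost all vectors lie in no translate of `ℓ_1`, then the average of the shifts is zero. -/
theorem isPettisAverage_coordShift_zero (e : HilbertBasis ℕ ℝ E) {ν : Measure E}
    [IsProbabilityMeasure ν]
    (hν : ∀ δ : ℕ → ℝ, ∀ᵐ h ∂ν, ¬ Summable fun k => |inner ℝ (e k) h + δ k|) :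
    IsPettisAverage (coordShift e) ν 0 := by
  refine isPettisAverage_of_dense (fun h f => FinAddMeasure.norm_L2comp_le _ f)
    (dense_range_coe_simple e) ?_
  rintro _ ⟨f, rfl⟩ _ ⟨g, rfl⟩
  -- For fixed `f` and `g` the supports of the shifted `f` and of `g` meet in a null set almost
  -- surely. The exceptional set may depend on `f` and `g`, which a weak integral permits.
  have hz : (fun h => inner ℂ (g : SquareIntegrable e) (coordShift e h (f : SquareIntegrable e)))
      =ᵐ[ν] fun _ => 0 := by
    filter_upwards [ae_shiftInvariantMeasure_inter_eq_zero e hν f.support_mem g.support_mem]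
      with h hh
    rw [coordShift, FinAddMeasure.L2comp_coe, UniformSpace.Completion.inner_coe]
    exact FinAddMeasure.Simple.inner_eq_zero hh
  refine ⟨(integrable_zero E ℂ ν).congr hz.symm, ?_⟩
  rw [integral_congr_ae hz]
  simp

end Overlap

/-! ### Identification of both averages and comparison at the unit cube. -/

section Averages

variable {E : Type*} [NormedAddCommGroup E] [InnerProductSpace ℝ E]

theorem coordQuad_const_mul (e : HilbertBasis ℕ ℝ E) (t : ℝ) (d : ℕ → ℝ) (x : E) :
    coordQuad e (fun k => t * d k) x = t * coordQuad e d x := by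
  simp only [coordQuad, mul_assoc, tsum_mul_left]

theorem truncate_const_mul (t : ℝ) (d : ℕ → ℝ) (n : ℕ) :
    truncate (fun k => t * d k) n = fun k => t * truncate d n k := by
  ext k
  simp [truncate]

theorem inner_diagOp_coordProj [CompleteSpace E] (e : HilbertBasis ℕ ℝ E) {d : ℕ → ℝ}
    (hs : Summable fun k => |d k|) (n : ℕ) (x : E) :
    inner ℝ (diagOp e d (coordProj e n x)) x = coordQuad e (truncate d n) x := by
  rw [← (hasSum_inner_coord e _ _).tsum_eq]
  refine tsum_congr fun k => ?_
  rw [inner_diagOp hs, inner_coordProj, truncate]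
  split_ifs <;> ring

/-- The indicator of the unit cube. -/
theorem exists_unit_cube (e : HilbertBasis ℕ ℝ E) :
    ∃ f : (shiftInvariantMeasure e).Simple, ‖f‖ = 1 ∧
      ∀ x ∈ Function.support f.toFun, x ∈ coordBox e 1 := by
  have hab : AbsMeasurableEdges (fun _ => 0) (fun _ => 1) :=
    ⟨⟨0, by simp⟩, ⟨1, by simp⟩, by simp, by simp⟩
  have hne : (block e (fun _ => 0) (fun _ => 1)).Nonempty := ⟨0, fun j => by simp⟩
  obtain ⟨hQ, hm⟩ := blockMeasure_block e hab hne
  have hQ' : _ ∈ (shiftInvariantMeasure e).sets := (blockMeasure e).subset_complSets hQ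
  refine ⟨FinAddMeasure.Simple.ind _ hQ', ?_, fun x hx j => ?_⟩
  · have h1 := FinAddMeasure.Simple.norm_ind_sq (μ := shiftInvariantMeasure e) _ hQ'
    have h2 : (shiftInvariantMeasure e).m (block e (fun _ => 0) (fun _ => 1)) = 1 :=
      ((blockMeasure e).complM_eq hQ).trans (by simpa using hm)
    exact (pow_eq_one_iff_of_nonneg (norm_nonneg _) two_ne_zero).1 (h1.trans h2)
  · have hx' : x ∈ block e (fun _ => 0) (fun _ => 1) := by
      by_contra h
      exact hx (by simp [FinAddMeasure.Simple.ind, FinAddMeasure.Simple.toFun, h])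
    rw [abs_le]
    constructor <;> linarith [(hx' j).1, (hx' j).2]

/-- On the unit cube all coordinates are at most 1 in modulus, so the weight is at least
$\exp(-\frac12\sum_k d_k)$, which is positive because the trace is finite. The indicator of the cube
is a unit vector. -/
theorem mulOp_gaussianWeight_ne_zero (e : HilbertBasis ℕ ℝ E) {d : ℕ → ℝ} (hd : ∀ k, 0 ≤ d k)
    (hs : Summable fun k => |d k|) :
    ∃ f, mulOp (isAdmissible_gaussianWeight (e := e) hd hs) f ≠ 0 := by
  obtain ⟨f, hf, hsupp⟩ := exists_unit_cube e
  refine ⟨(f : SquareIntegrable e), fun h0 => ?_⟩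
  have h := le_norm_mulOp (isAdmissible_gaussianWeight (e := e) hd hs) (f := f)
    (c := Real.exp (-(1 / 2) * ∑' k, |d k|)) (Real.exp_pos _) fun x hx => by
      rw [norm_gaussianWeight]
      refine Real.exp_le_exp.2 (mul_le_mul_of_nonpos_left ?_ (by norm_num))
      refine (summable_coordQuad hs x).tsum_le_tsum (fun k => ?_) hs
      rw [abs_of_nonneg (hd k)]
      exact mul_le_of_le_one_right (hd k) ((sq_le_one_iff_abs_le_one _).2 (hsupp x hx k))
  rw [h0, norm_zero, UniformSpace.Completion.norm_coe, hf, mul_one] at h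
  linarith [Real.exp_pos (-(1 / 2) * ∑' k, |d k|)]

theorem summable_abs_one_div_sq : Summable fun k : ℕ => |1 / ((k : ℝ) + 1) ^ 2| := by
  have := (summable_nat_add_iff 1).2 (Real.summable_one_div_nat_pow.2 one_lt_two)
  refine this.congr fun k => ?_
  rw [abs_of_nonneg (by positivity)]
  push_cast
  rfl

/-- The square root equals $\sqrt t/(k+1)$, and each term is at least $\frac{\sqrt t}{1+\sqrt
t}\cdot\frac1{k+1}$: a multiple of the harmonic series. -/
theorem not_summable_sqrt {t : ℝ} (ht : 0 < t) :
    ¬ Summable fun k : ℕ => √(t * (1 / ((k : ℝ) + 1) ^ 2)) /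
      (1 + √(t * (1 / ((k : ℝ) + 1) ^ 2))) := by
  intro h
  have hs : 0 < √t := Real.sqrt_pos.2 ht
  have h1 : Summable fun k : ℕ => √t / (1 + √t) * (1 / ((k : ℝ) + 1)) := by
    refine Summable.of_nonneg_of_le (fun k => by positivity) (fun k => ?_) h
    have hk : (0 : ℝ) < k + 1 := by positivity
    have hk0 : (0 : ℝ) ≤ k := by positivity
    have e1 : √(t * (1 / ((k : ℝ) + 1) ^ 2)) = √t / (k + 1) := by
      rw [mul_one_div, Real.sqrt_div ht.le, Real.sqrt_sq hk.le]
    rw [e1, div_mul_div_comm, mul_one, div_le_div_iff₀ (by positivity) (by positivity)]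
    have e2 : √t / ((k : ℝ) + 1) * ((1 + √t) * (k + 1)) = √t * (1 + √t) := by field_simp
    rw [e2]
    refine mul_le_mul_of_nonneg_left (add_le_add le_rfl ?_) hs.le
    rw [div_le_iff₀ hk]
    nlinarith
  have h2 := (summable_mul_left_iff (by positivity : √t / (1 + √t) ≠ 0)).1 h1
  have h3 : Summable fun k : ℕ => 1 / (((k + 1 : ℕ)) : ℝ) := h2.congr fun k => by push_cast; rfl
  exact Real.not_summable_one_div_natCast ((summable_nat_add_iff 1).1 h3)

variable [MeasurableSpace E] [BorelSpace E]

theorem isCoordAverage_zero (e : HilbertBasis ℕ ℝ E) {d : ℕ → ℝ} (hd : ∀ k, 0 ≤ d k)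
    (hs : Summable fun k => |d k|) (hn : ¬ Summable fun k => √(d k) / (1 + √(d k)))
    {D : E →L[ℝ] E} (hD : ∀ x, inner ℝ (D x) x = coordQuad e d x) : IsCoordAverage e D 0 := by
  obtain ⟨ν, hν, hchar, -, hdiv⟩ := exists_gaussianMeasure e hd hs
  refine ⟨ν, ⟨hν, fun ξ => ?_⟩, isPettisAverage_coordShift_zero e (hdiv hn)⟩
  rw [hchar, hD, gaussianWeight, Complex.ofReal_exp]

/-- With zero covariance the vector is almost surely the origin, where the shift is the identity.
This case is needed because the families of averages are indexed by all $t \ge 0$. -/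
theorem isCoordAverage_of_eq_zero (e : HilbertBasis ℕ ℝ E) :
    IsCoordAverage e (0 : E →L[ℝ] E) (ContinuousLinearMap.id ℂ _) := by
  obtain ⟨ν, hν, hchar, hzero, -⟩ := exists_gaussianMeasure e (d := 0) (fun _ => le_rfl)
    (by simp)
  refine ⟨ν, ⟨hν, fun ξ => ?_⟩, fun f g => ?_⟩
  · simp [hchar, gaussianWeight, coordQuad]
  have hae : (fun h => inner ℂ g (coordShift e h f)) =ᵐ[ν] fun _ => inner ℂ g f := by
    filter_upwards [ae_all_iff.2 fun k => hzero k rfl] with h hh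
    have : h = 0 := e.ext_coord fun j => by simpa using hh j
    rw [this, coordShift_zero]
  refine ⟨(integrable_const _).congr hae.symm, ?_⟩
  rw [integral_congr_ae hae]
  simp

/-- Almost all vectors have vanishing coordinates from `n` on, hence lie in $\ell_1$. The average of
the characters $e^{i(h,x)}$ over `h` is the characteristic function at `x`, which is the Gaussian
weight. -/
theorem isMomentumPettisAverage_truncate (e : HilbertBasis ℕ ℝ E) {d : ℕ → ℝ}
    (hd : ∀ k, 0 ≤ d k) (n : ℕ) {D : E →L[ℝ] E}
    (hD : ∀ x, inner ℝ (D x) x = coordQuad e (truncate d n) x) :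
    IsMomentumPettisAverage e D (mulOp (isAdmissible_gaussianWeight (e := e)
      (truncate_nonneg hd n) (summable_abs_truncate d n))) := by
  classical
  obtain ⟨ν, hν, hchar, hzero, -⟩ := exists_gaussianMeasure e (truncate_nonneg hd n)
    (summable_abs_truncate d n)
  -- The value 0 outside `L1coord e` is arbitrary: it affects only a null set and keeps every `T h`
  -- a contraction.
  set T : E → SquareIntegrable e →L[ℂ] SquareIntegrable e := fun h =>
    if hh : h ∈ L1coord e then mulOp (isAdmissible_character hh) else 0 with hT
  have hae : ∀ᵐ h ∂ν, h ∈ L1coord e := by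
    have : ∀ᵐ h ∂ν, ∀ k, n ≤ k → inner ℝ (e k) h = 0 := by
      rw [ae_all_iff]
      intro k
      by_cases hk : n ≤ k
      · filter_upwards [hzero k (if_neg (not_lt.2 hk))] with h hh _ using hh
      · exact Eventually.of_forall fun h h' => absurd h' hk
    filter_upwards [this] with h hh using mem_L1coord_of_eventually_zero hh
  refine ⟨ν, T, ⟨hν, fun ξ => ?_⟩, hae, fun h hh => ?_, ?_⟩
  · rw [hchar, hD, gaussianWeight, Complex.ofReal_exp]
  · simp only [hT, dif_pos hh]
    exact isMomentumShift_mulOp hh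
  · refine isPettisAverage_mulOp ν (φ := character) (fun h f => ?_) ?_ (fun x => ?_) _ fun x => ?_
    · by_cases hh : h ∈ L1coord e
      · simp only [hT, dif_pos hh]
        exact norm_mulOp_le _ f
      · simp [hT, dif_neg hh]
    · filter_upwards [hae] with h hh
      exact ⟨isAdmissible_character hh, dif_pos hh⟩
    · refine Measurable.aestronglyMeasurable ?_
      unfold character
      fun_prop
    · rw [← hchar, charFun_apply]
      simp only [character, mul_comm Complex.I]

theorem isMomentumAverage_mulOp (e : HilbertBasis ℕ ℝ E) {d : ℕ → ℝ} (hd : ∀ k, 0 ≤ d k)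
    (hs : Summable fun k => |d k|) {D : E →L[ℝ] E}
    (hD : ∀ n x, inner ℝ (D (coordProj e n x)) x = coordQuad e (truncate d n) x) :
    IsMomentumAverage e D (mulOp (isAdmissible_gaussianWeight (e := e) hd hs)) :=
  ⟨_, fun n => isMomentumPettisAverage_truncate e hd n (hD n), strongLimit_gaussianWeight hd hs⟩

end Averages

end

/-! ### The contradiction. -/

theorem mainTheorem1 {E : Type*} [NormedAddCommGroup E] [InnerProductSpace ℝ E] [CompleteSpace E]
    [MeasurableSpace E] [BorelSpace E] (e : HilbertBasis ℕ ℝ E) :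
    ¬ ∃ F : SquareIntegrable e ≃ₗᵢ[ℂ] SquareIntegrable e,
      ∀ D : E →L[ℝ] E, D.IsPositive → IsNuclear D → (∀ k, ∃ d : ℝ, D (e k) = d • e k) →
        ∀ U V : ℝ → SquareIntegrable e →L[ℂ] SquareIntegrable e,
          (∀ t, 0 ≤ t → IsCoordAverage e (t • D) (U t)) →
          (∀ t, 0 ≤ t → IsMomentumAverage e (t • D) (V t)) →
          ∀ t, 0 ≤ t → ∀ f, U t f = F (V t (F.symm f)) := by
  classical
  rintro ⟨F, hF⟩
  -- Summable eigenvalues whose square roots form the harmonic series: `D` is nuclear and its square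
  -- root is not.
  set d : ℕ → ℝ := fun k => 1 / ((k : ℝ) + 1) ^ 2 with hd
  have hs : Summable fun k => |d k| := summable_abs_one_div_sq
  have hd0 : ∀ k, 0 ≤ d k := fun k => by positivity
  -- The absolute value of `t` makes the momentum family defined for every real `t`; it disappears
  -- where `t` is non-negative.
  have hst : ∀ t : ℝ, Summable fun k => |(|t| * d k)| := fun t => by
    simpa only [abs_mul] using hs.mul_left |(|t|)|
  have hdt : ∀ (t : ℝ) (k : ℕ), 0 ≤ |t| * d k := fun t k => mul_nonneg (abs_nonneg t) (hd0 k)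
  have h := hF (diagOp e d) (isPositive_diagOp hs hd0) (isNuclear_diagOp hs)
    (fun k => ⟨d k, diagOp_apply_basis hs k⟩)
    -- The coordinate averages jump: the identity at `t = 0` and zero for every `t > 0`.
    (fun t => if t = 0 then ContinuousLinearMap.id ℂ _ else 0)
    (fun t => mulOp (isAdmissible_gaussianWeight (e := e) (hdt t) (hst t))) ?_ ?_ 1 zero_le_one
  · obtain ⟨f, hf⟩ := mulOp_gaussianWeight_ne_zero e (hdt 1) (hst 1)
    -- At `F f` the intertwining relation says that `F` sends the nonzero vector obtained from `f`
    -- by the Gaussian weight to zero.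
    have h1 := h (F f)
    rw [if_neg one_ne_zero, F.symm_apply_apply, zero_apply] at h1
    exact hf (F.map_eq_zero_iff.1 h1.symm)
  · intro t ht
    rcases ht.eq_or_lt with rfl | ht
    · simpa using isCoordAverage_of_eq_zero e
    · simp only [if_neg ht.ne']
      refine isCoordAverage_zero e (d := fun k => t * d k) (fun k => mul_nonneg ht.le (hd0 k))
        (by simpa only [abs_of_pos ht] using hst t) (not_summable_sqrt ht) fun x => ?_
      rw [smul_apply, real_inner_smul_left, inner_diagOp_self hs,
        coordQuad_const_mul]
  · intro t ht
    refine isMomentumAverage_mulOp e (hdt t) (hst t) fun n x => ?_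
    rw [smul_apply, real_inner_smul_left, inner_diagOp_coordProj e hs,
      truncate_const_mul, coordQuad_const_mul, abs_of_nonneg ht]
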